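/- Let $k$ be an algebraically closed field of characteristic $p>0$, let $R$ be a regular ring that is a $k$-algebra essentially of finite type, and let $K\supseteq k$ be an algebraically closed extension field; put $R_K=K\otimes_k R$. For $e\ge 1$, an $R[F^e]$-module is an $R$-module $M$ with an additive map $F^e\colon M\to M$ such that $F^e(rm)=r^{p^e}F^e(m)$, equivalently with an $R$-linear map $\theta^e\colon R^e\otimes_R M\to M$, $r\otimes m\mapsto rF^e(m)$, where $R^e$ is $R$ with right $R$-action twisted by the $e$-th iterate of the Frobenius; it is called unit if $\theta^e$ is an isomorphism, and finitely generated if it is so over the (noncommutative) ring $R[F^e]$. An $R[F^e]$-module is an $R[F^{er}]$-module for every $r>0$ through the $r$-fold iterate of $F^e$, and the category of (unit) $R[F]$-modules is the directed limit of the categories of (unit) $R[F^e]$-modules. Let $M$ be a finitely generated unit $R[F^e]$-module, and equip $K\otimes_k M$ with the $R_K[F^e]$-module structure $a\otimes m\mapsto a^{p^e}\otimes F^e(m)$. (1) If $M$ is simple as a unit $R[F^e]$-module (that is, $M\neq 0$ and its only unit $R[F^e]$-submodules are $0$ and $M$), then $K\otimes_k M$ is simple as a unit $R_K[F^e]$-module.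 (2) If $M$ is simple as a unit $R[F]$-module (that is, $M\ne 0$ and, for every $r>0$, its only unit $R[F^{er}]$-submodules are $0$ and $M$), then $K\otimes_k M$ is simple as a unit $R_K[F]$-module. -/

import Mathlib

open scoped TensorProduct

namespace FrobMod

section Basic

variable {R : Type*} [CommRing R] {p : ℕ} [ExpChar R p] {e : ℕ} {M : Type*} [AddCommGroup M]
  [Module R M]

/-- The bimodule `R^e`: as a ring (and left module) it is `R`; the other `R`-module structure is
twisted by the `e`-th iterate of the Frobenius. -/
def FrobTwist (R : Type*) (_p _e : ℕ) : Type _ := R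

instance (R : Type*) [CommRing R] (p e : ℕ) : CommRing (FrobTwist R p e) :=
  inferInstanceAs (CommRing R)

/-- The identity map `R^e → R`, a ring isomorphism. -/
def FrobTwist.toRing (R : Type*) [CommRing R] (p e : ℕ) : FrobTwist R p e ≃+* R :=
  RingEquiv.refl R

/-- The twisted structure: `r` acts on `R^e` as multiplication by `r ^ p ^ e`. -/
instance (R : Type*) [CommRing R] (p e : ℕ) [ExpChar R p] : Algebra R (FrobTwist R p e) :=
  ((FrobTwist.toRing R p e).symm.toRingHom.comp (iterateFrobenius R p e)).toAlgebra

theorem FrobTwist.toRing_smul (r : R) (a : FrobTwist R p e) :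
    FrobTwist.toRing R p e (r • a) = r ^ p ^ e * FrobTwist.toRing R p e a := rfl

/-- The Frobenius pullback `F^{e*} M = R^e ⊗_R M`. It is an `R`-module through the left factor,
i.e. a module over `FrobTwist R p e ≃+* R`. -/
abbrev Pullback (R : Type*) [CommRing R] (p e : ℕ) [ExpChar R p] (M : Type*) [AddCommGroup M]
    [Module R M] : Type _ :=
  FrobTwist R p e ⊗[R] M

/-- The additive map `R^e ⊗_R M → M`, `r ⊗ m ↦ r • F m`. -/
def thetaAux (F : M →ₛₗ[iterateFrobenius R p e] M) : Pullback R p e M →+ M :=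
  TensorProduct.liftAddHom
    (AddMonoidHom.mk' (fun a => AddMonoidHom.mk' (fun m => FrobTwist.toRing R p e a • F m)
        (fun m n => by rw [map_add, smul_add]))
      (fun a b => by
        ext m
        exact add_smul (FrobTwist.toRing R p e a) (FrobTwist.toRing R p e b) (F m)))
    (fun r a m => by
      change FrobTwist.toRing R p e (r • a) • F m = FrobTwist.toRing R p e a • F (r • m)
      rw [FrobTwist.toRing_smul, LinearMap.map_smulₛₗ, iterateFrobenius_def, smul_smul, mul_comm])

/-- An `R[F^e]`-module is an `R`-module `M` with an additive map `F : M → M` such that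
`F (r • m) = r ^ p ^ e • F m`; this is the (linear) structure map
`θ : R^e ⊗_R M → M`, `r ⊗ m ↦ r • F m`, adjoint to `F`. -/
def theta (F : M →ₛₗ[iterateFrobenius R p e] M) :
    Pullback R p e M →ₛₗ[(FrobTwist.toRing R p e : FrobTwist R p e →+* R)] M where
  toFun := thetaAux F
  map_add' := map_add _
  map_smul' c x := by
    induction x using TensorProduct.induction_on with
    | zero => rw [smul_zero, map_zero, smul_zero]
    | add x y hx hy => rw [smul_add, map_add, map_add, smul_add, hx, hy]
    | tmul a m => exact mul_smul (FrobTwist.toRing R p e c) (FrobTwist.toRing R p e a) (F m)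

theorem theta_tmul (F : M →ₛₗ[iterateFrobenius R p e] M) (a : FrobTwist R p e) (m : M) :
    theta F (a ⊗ₜ[R] m) = FrobTwist.toRing R p e a • F m := rfl

/-- `(M, F)` is a unit `R[F^e]`-module: `θ : F^{e*} M → M` is an isomorphism. -/
def IsUnitModule (F : M →ₛₗ[iterateFrobenius R p e] M) : Prop :=
  Function.Bijective (theta F)

/-- `(M, F)` is finitely generated as a module over the ring `R[F^e]`: for some finite subset `S`,
the only `R[F^e]`-submodule of `M` (`R`-submodule stable under `F`) containing `S` is `M`. -/
def IsFG (F : M →ₛₗ[iterateFrobenius R p e] M) : Prop :=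
  ∃ S : Finset M, ∀ N : Submodule R M, (↑S ⊆ (N : Set M)) → (∀ x ∈ N, F x ∈ N) → N = ⊤

/-- The Frobenius action on an `F`-stable submodule. -/
def restrict (F : M →ₛₗ[iterateFrobenius R p e] M) (N : Submodule R M) (h : ∀ x ∈ N, F x ∈ N) :
    N →ₛₗ[iterateFrobenius R p e] N where
  toFun x := ⟨F x, h x x.2⟩
  map_add' x y := by ext; simp
  map_smul' r x := by ext; simp

/-- `N` is a unit `R[F^e]`-submodule of `M`: it is stable under `F` and, with the induced
Frobenius action, is itself a unit `R[F^e]`-module. -/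
def IsUnitSubmodule (F : M →ₛₗ[iterateFrobenius R p e] M) (N : Submodule R M) : Prop :=
  ∃ h : ∀ x ∈ N, F x ∈ N, IsUnitModule (restrict F N h)

/-- The `R[F^{er}]`-module underlying an `R[F^e]`-module: its Frobenius action is the `r`-fold
iterate of `F`. -/
def frobPow (F : M →ₛₗ[iterateFrobenius R p e] M) (r : ℕ) :
    M →ₛₗ[iterateFrobenius R p (e * r)] M where
  toFun := F^[r]
  map_add' x y := iterate_map_add F r x y
  map_smul' a x := by
    induction r with
    | zero => simp
    | succ r ih =>
      rw [Function.iterate_succ_apply', Function.iterate_succ_apply', ih, LinearMap.map_smulₛₗ]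
      congr 1
      simp only [iterateFrobenius_def]
      rw [← pow_mul, ← pow_add, mul_add, mul_one]

/-- `(M, F)` is simple as a unit `R[F^e]`-module: it is a nonzero unit `R[F^e]`-module whose only
unit `R[F^e]`-submodules are `0` and `M`. -/
def IsSimpleUnit (F : M →ₛₗ[iterateFrobenius R p e] M) : Prop :=
  IsUnitModule F ∧ Nontrivial M ∧ ∀ N : Submodule R M, IsUnitSubmodule F N → N = ⊥ ∨ N = ⊤

/-- `N` is a unit `R[F]`-submodule of `M`, where the category of unit `R[F]`-modules is the
directed limit of the categories of unit `R[F^e]`-modules: `N` is a unit `R[F^{er}]`-submodule for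
some `r > 0`. -/
def IsUnitSubmoduleLim (F : M →ₛₗ[iterateFrobenius R p e] M) (N : Submodule R M) : Prop :=
  ∃ r : ℕ, 0 < r ∧ IsUnitSubmodule (frobPow F r) N

/-- `(M, F)` is simple as a unit `R[F]`-module: it is a nonzero unit `R[F]`-module whose only
unit `R[F]`-submodules are `0` and `M`. -/
def IsSimpleUnitLim (F : M →ₛₗ[iterateFrobenius R p e] M) : Prop :=
  IsUnitModule F ∧ Nontrivial M ∧ ∀ N : Submodule R M, IsUnitSubmoduleLim F N → N = ⊥ ∨ N = ⊤

end Basic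

section BaseChange

variable (k K R : Type*) [Field k] [Field K] [Algebra k K] [CommRing R] [Algebra k R]

/-- `R_K = K ⊗_k R` has the same characteristic as `R`. -/
instance expCharTensor (p : ℕ) [ExpChar R p] : ExpChar (K ⊗[k] R) p :=
  expChar_of_injective_ringHom
    (f := (Algebra.TensorProduct.includeRight : R →ₐ[k] K ⊗[k] R).toRingHom)
    (Algebra.TensorProduct.includeRight_injective (algebraMap k K).injective) p

theorem nontrivial_of_expChar (p : ℕ) [h : ExpChar R p] : Nontrivial R := by
  cases h with
  | zero => infer_instance
  | prime hp => exact CharP.nontrivial_of_char_ne_one hp.ne_one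

theorem expChar_ext (k K R : Type*) [Field k] [Field K] [Algebra k K] [CommRing R] [Algebra k R]
    (p : ℕ) [ExpChar R p] : ExpChar K p := by
  have := nontrivial_of_expChar R p
  have : ExpChar k p := ((algebraMap k R).expChar_iff (algebraMap k R).injective p).mpr ‹_›
  exact expChar_of_injective_algebraMap (algebraMap k K).injective p

variable (M : Type*) [AddCommGroup M] [Module k M] [Module R M] [IsScalarTower k R M]

/-- The `R_K`-module structure of `K ⊗_k M`, characterized by
`(a ⊗ r) • (b ⊗ m) = (a * b) ⊗ (r • m)`. -/
instance tensorModule : Module (K ⊗[k] R) (K ⊗[k] M) :=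
  Module.compHom (K ⊗[k] M)
    ((Module.endTensorEndAlgHom (R := k) (S := k) (A := k) (M := K) (N := M)).comp
      (Algebra.TensorProduct.map (Algebra.lmul k K) (Algebra.lsmul k k M))).toRingHom

variable {k K R M}

theorem tmul_smul_tmul (a b : K) (r : R) (m : M) :
    (a ⊗ₜ[k] r) • (b ⊗ₜ[k] m) = (a * b) ⊗ₜ[k] (r • m) := rfl

variable (K) in
/-- The additive map `a ⊗ m ↦ a ^ p ^ e ⊗ F m` on `K ⊗_k M`. -/
def baseChangeAux {p e : ℕ} [ExpChar R p] (F : M →ₛₗ[iterateFrobenius R p e] M) :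
    K ⊗[k] M →+ K ⊗[k] M :=
  TensorProduct.liftAddHom
    (AddMonoidHom.mk' (fun a : K => AddMonoidHom.mk' (fun m => (a ^ p ^ e) ⊗ₜ[k] F m)
        (fun m n => by rw [map_add, TensorProduct.tmul_add]))
      (fun a b => by
        have := expChar_ext k K R p
        ext m
        change ((a + b) ^ p ^ e) ⊗ₜ[k] F m = (a ^ p ^ e) ⊗ₜ[k] F m + (b ^ p ^ e) ⊗ₜ[k] F m
        rw [add_pow_expChar_pow, TensorProduct.add_tmul]))
    (fun c a m => by
      have h : F (c • m) = (c ^ p ^ e) • F m := by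
        rw [← algebraMap_smul R c m, LinearMap.map_smulₛₗ, iterateFrobenius_def, ← map_pow,
          algebraMap_smul]
      change ((c • a) ^ p ^ e) ⊗ₜ[k] F m = (a ^ p ^ e) ⊗ₜ[k] F (c • m)
      rw [h, smul_pow, TensorProduct.smul_tmul])

variable (K) in
/-- The base change of an `R[F^e]`-module to `R_K = K ⊗_k R`: the Frobenius action on `K ⊗_k M`
is `a ⊗ m ↦ a ^ p ^ e ⊗ F m`. -/
def baseChange {p e : ℕ} [ExpChar R p] (F : M →ₛₗ[iterateFrobenius R p e] M) :
    K ⊗[k] M →ₛₗ[iterateFrobenius (K ⊗[k] R) p e] K ⊗[k] M where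
  toFun := baseChangeAux K F
  map_add' := map_add _
  map_smul' x y := by
    induction y using TensorProduct.induction_on with
    | zero => rw [smul_zero, map_zero, smul_zero]
    | add y z hy hz => rw [smul_add, map_add, map_add, smul_add, hy, hz]
    | tmul b m =>
      induction x using TensorProduct.induction_on with
      | zero => rw [zero_smul, map_zero, map_zero, zero_smul]
      | add x z hx hz => rw [add_smul, map_add, map_add, add_smul, hx, hz]
      | tmul a r =>
        rw [tmul_smul_tmul, iterateFrobenius_def, Algebra.TensorProduct.tmul_pow]
        change ((a * b) ^ p ^ e) ⊗ₜ[k] F (r • m) = _ • ((b ^ p ^ e) ⊗ₜ[k] F m)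
        rw [tmul_smul_tmul, LinearMap.map_smulₛₗ, iterateFrobenius_def, mul_pow]

theorem baseChange_tmul {p e : ℕ} [ExpChar R p] (F : M →ₛₗ[iterateFrobenius R p e] M)
    (a : K) (m : M) : baseChange K F (a ⊗ₜ[k] m) = (a ^ p ^ e) ⊗ₜ[k] F m := rfl

end BaseChange

end FrobMod

/-! The heart of the matter is that every unit submodule `N` of `K ⊗ M` is defined over `k`, that
is, spanned over `K` by elements `1 ⊗ m` (`toSubspace_le_span_one_tmul`). Granting this, the
submodule `contraction N` of `M` is generated by its own Frobenius image
(`frobSpan_contraction_eq`), hence is a unit submodule because the Frobenius of `R` is flat. By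
simplicity it is `0` or `M`, and since it generates `N`, so is `N`.

To see that `N` is defined over `k`, note that `R_K` is noetherian with flat Frobenius, so `N` has a
root (`exists_root_of_isUnitSubmodule`): a finitely generated `X` contained in the span of `F X`,
whose successive Frobenius transforms exhaust `N`. Generators of `X` involve finitely many scalars,
so they lie in the image of `E ⊗ M` for a finitely generated field extension `E` of `k`. Since `F`
raises scalars to the power `p ^ e`, the `n`-th transform is generated by elements rational over `E
^ (p ^ (e n))`. The transforms increase to `N`, so `N` is spanned by elements rational over each of
these fields. Their intersection is `k` (`mem_range_algebraMap_of_forall_exists_pow`), and a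
coordinate argument descends `N` to it (`le_span_one_tmul`).

Flatness of Frobenius is Kunz's theorem for `R` (`flat_frobTwist`): in a regular local ring powers
of a regular system of parameters are again a regular sequence, and the local criterion applies. It
passes to `R_K` without any regularity of `R_K`, because over the perfect field `k` the Frobenius of
`K ⊗ R` is the tensor product of those of `K` and `R` (`flat_frobTwist_tensorProduct`).

The second assertion is the first applied to every iterate of `F`. -/

namespace FrobMod

/-! ### The local criterion of flatness. -/

section LocalCriterion

open Submodule LinearMap

/-- If `P → N × N₁ → Q` is exact, with components `f, g` and `u, v`, then an element of `B ⊗ N`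
killed by `u` comes from an element of `B ⊗ P` killed by `g`. -/
theorem exists_lTensor_eq_of_exact {A B P N N₁ Q : Type*} [CommRing A] [AddCommGroup B]
    [Module A B] [AddCommGroup P] [Module A P] [AddCommGroup N] [Module A N] [AddCommGroup N₁]
    [Module A N₁] [AddCommGroup Q] [Module A Q] (f : P →ₗ[A] N) (g : P →ₗ[A] N₁)
    (u : N →ₗ[A] Q) (v : N₁ →ₗ[A] Q) (hex : Function.Exact (f.prod g) (u.coprod v))
    (hs : Function.Surjective (u.coprod v)) (z : B ⊗[A] N) (hz : u.lTensor B z = 0) :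
    ∃ w : B ⊗[A] P, f.lTensor B w = z ∧ g.lTensor B w = 0 := by
  have h := lTensor_exact B hex hs
  obtain ⟨w, hw⟩ := (h ((LinearMap.inl A N N₁).lTensor B z)).1 (by
    rw [← LinearMap.comp_apply, ← LinearMap.lTensor_comp, LinearMap.coprod_inl, hz])
  refine ⟨w, ?_, ?_⟩
  · have := congrArg ((LinearMap.fst A N N₁).lTensor B) hw
    simpa only [← LinearMap.comp_apply, ← LinearMap.lTensor_comp, LinearMap.fst_prod,
      LinearMap.fst_comp_inl, LinearMap.lTensor_id, LinearMap.id_apply] using this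
  · have := congrArg ((LinearMap.snd A N N₁).lTensor B) hw
    simpa only [← LinearMap.comp_apply, ← LinearMap.lTensor_comp, LinearMap.snd_prod,
      LinearMap.snd_comp_inl, LinearMap.lTensor_zero, LinearMap.zero_apply] using this

variable {A B : Type*} [CommRing A]

/-- Enlarging an ideal by one element annihilated by `I` modulo it does not create kernel. -/
theorem lTensor_inclusion_injective_of_sup_span [AddCommGroup B] [Module A B] {I J J' : Ideal A}
    (hI : Function.Injective (I.subtype.lTensor B)) (hJ : J ≤ J') {y : A} (hy : y ∈ J')
    (hsup : J' ≤ J ⊔ Ideal.span {y}) (hIy : ∀ a, a * y ∈ J ↔ a ∈ I) :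
    Function.Injective ((Submodule.inclusion hJ).lTensor B) := by
  rw [injective_iff_map_eq_zero]
  intro z hz
  let yy : J' := ⟨y, hy⟩
  let f : I →ₗ[A] J := LinearMap.codRestrict J ((LinearMap.toSpanSingleton A A y).comp I.subtype)
    (fun a => (hIy a).2 a.2)
  -- The sequence is `I → J × A → J'` with `a ↦ (a y, -a)` and `(j, a) ↦ j + a y`: the relations
  -- between `J` and `y` are exactly the elements of `I`.
  have H := exists_lTensor_eq_of_exact (B := B) f (-I.subtype) (Submodule.inclusion hJ)
    (LinearMap.toSpanSingleton A J' yy)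
  obtain ⟨w, hw, hw'⟩ : ∃ w : B ⊗[A] I, f.lTensor B w = z ∧ (-I.subtype).lTensor B w = 0 := by
    refine H ?_ ?_ z hz
    · rintro ⟨⟨j, hj⟩, a⟩
      constructor
      · intro h
        have h' : j + a * y = 0 := congrArg Subtype.val h
        have ha : -a ∈ I := by
          rw [← hIy, neg_mul, neg_mem_iff, ← add_mem_cancel_left hj, h']
          exact J.zero_mem
        refine ⟨⟨-a, ha⟩, ?_⟩
        ext
        · change -a * y = j
          linear_combination -h'
        · change - -a = a
          ring
      · rintro ⟨a', h⟩
        obtain ⟨h1, h2⟩ := Prod.ext_iff.1 h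
        have h1 : (a' : A) * y = j := congrArg Subtype.val h1
        have h2 : -(a' : A) = a := h2
        ext
        change j + a * y = 0
        rw [← h1, ← h2]; ring
    · rintro ⟨x, hx⟩
      obtain ⟨j, hj, b, hb, h⟩ := Submodule.mem_sup.1 (hsup hx)
      obtain ⟨a, rfl⟩ := Ideal.mem_span_singleton'.1 hb
      exact ⟨(⟨j, hj⟩, a), Subtype.ext h⟩
  rw [LinearMap.lTensor_neg, LinearMap.neg_apply, neg_eq_zero] at hw'
  rw [← hw, (injective_iff_map_eq_zero _).1 hI w hw', map_zero]

/-- Noetherian induction from above: a proper `J` containing a power of the maximal ideal admits `y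
∉ J` with `𝔪 y ⊆ J`. The step from `J` to `J + (y)` is controlled by the hypothesis on `𝔪`, and the
larger ideal is covered by induction. -/
theorem lTensor_subtype_injective_of_pow_le [AddCommGroup B] [Module A B] [IsNoetherianRing A]
    [IsLocalRing A] (hm : Function.Injective ((IsLocalRing.maximalIdeal A).subtype.lTensor B))
    (J : Ideal A) : (∃ n, IsLocalRing.maximalIdeal A ^ n ≤ J) →
      Function.Injective (J.subtype.lTensor B) := by
  induction J using IsNoetherian.induction (R := A) (M := A) with
  | hgt J ih =>
    rintro ⟨n, hn⟩
    by_cases hJ : J = ⊤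
    · subst hJ
      exact ((Submodule.topEquiv (R := A) (M := A)).lTensor B).injective
    · classical
      have hex : ∃ n, IsLocalRing.maximalIdeal A ^ n ≤ J := ⟨n, hn⟩
      have h0 : Nat.find hex ≠ 0 := by
        intro h
        have := Nat.find_spec hex
        rw [h, pow_zero, Ideal.one_eq_top, top_le_iff] at this
        exact hJ this
      -- With `r + 1` the least exponent whose power of `𝔪` lies in `J`, any `y ∈ 𝔪 ^ r` outside `J`
      -- satisfies `𝔪 y ⊆ J`.
      obtain ⟨r, hr⟩ := Nat.exists_eq_succ_of_ne_zero h0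
      have h1 := Nat.find_min hex (m := r) (by omega)
      obtain ⟨y, hy, hyJ⟩ := Set.not_subset.1 h1
      have hle : J ≤ J ⊔ Ideal.span {y} := le_sup_left
      have hyJ' : y ∈ J ⊔ Ideal.span {y} := Ideal.mem_sup_right (Ideal.mem_span_singleton_self y)
      have hlt : J < J ⊔ Ideal.span {y} := lt_of_le_of_ne hle (fun h => hyJ (by
        have := hyJ'; rw [← h] at this; exact this))
      have h2 := ih _ hlt ⟨n, hn.trans hle⟩
      have h3 := lTensor_inclusion_injective_of_sup_span hm hle hyJ' le_rfl (fun a => ?_)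
      · have : J.subtype.lTensor B = ((J ⊔ Ideal.span {y}).subtype.lTensor B).comp
            ((Submodule.inclusion hle).lTensor B) := by
          rw [← LinearMap.lTensor_comp]; rfl
        rw [this]
        exact h2.comp h3
      · constructor
        · intro ha
          by_contra hna
          rw [IsLocalRing.mem_maximalIdeal, mem_nonunits_iff, not_not] at hna
          exact hyJ ((Ideal.unit_mul_mem_iff_mem J hna).1 ha)
        · intro ha
          apply Nat.find_spec hex
          rw [hr, Nat.succ_eq_add_one, pow_succ']
          exact Ideal.mul_mem_mul ha hy

/-- Factors from `m ^ i` cross the tensor sign to the side of `B`. Together with Artin–Rees, this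
turns adic depth in `I` into adic depth in `B ⊗ I`, where Krull's intersection theorem applies. -/
theorem tmul_mem_pow_smul [CommRing B] [Algebra A B] (m I : Ideal A) (i : ℕ) (b : B) (a : A)
    (ha : a ∈ m ^ i • I) (haI : a ∈ I) : b ⊗ₜ[A] (⟨a, haI⟩ : I) ∈
      (m.map (algebraMap A B)) ^ i • (⊤ : Submodule B (B ⊗[A] I)) := by
  induction ha using Submodule.smul_induction_on' with
  | smul r hr n hn =>
    have : b ⊗ₜ[A] (⟨r • n, haI⟩ : I) = (algebraMap A B r) • (b ⊗ₜ[A] (⟨n, hn⟩ : I)) := by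
      rw [algebraMap_smul, ← TensorProduct.tmul_smul]; rfl
    rw [this, ← Ideal.map_pow]
    exact Submodule.smul_mem_smul (Ideal.mem_map_of_mem _ hr) trivial
  | add x hx y hy ihx ihy =>
    have hxI : x ∈ I := Ideal.mul_le_right hx
    have hyI : y ∈ I := Ideal.mul_le_right hy
    have : b ⊗ₜ[A] (⟨x + y, haI⟩ : I) = b ⊗ₜ[A] (⟨x, hxI⟩ : I) + b ⊗ₜ[A] (⟨y, hyI⟩ : I) := by
      rw [← TensorProduct.tmul_add]; rfl
    rw [this]
    exact add_mem (ihx hxI) (ihy hyI)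

theorem lTensor_inclusion_mem_pow_smul [CommRing B] [Algebra A B] (m I J : Ideal A) {hJI : J ≤ I}
    (i : ℕ) (hJ : ∀ a ∈ J, a ∈ m ^ i • I) (w : B ⊗[A] J) :
    (Submodule.inclusion hJI).lTensor B w ∈
      (m.map (algebraMap A B)) ^ i • (⊤ : Submodule B (B ⊗[A] I)) := by
  induction w using TensorProduct.induction_on with
  | zero => rw [map_zero]; exact zero_mem _
  | add x y hx hy => rw [map_add]; exact add_mem hx hy
  | tmul b a => exact tmul_mem_pow_smul m I i b a (hJ a a.2) (hJI a.2)

/-- Local criterion of flatness. -/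
theorem flat_of_lTensor_maximalIdeal_injective [CommRing B] [Algebra A B] [IsNoetherianRing A]
    [IsLocalRing A] [IsNoetherianRing B] [IsLocalRing B] [IsLocalHom (algebraMap A B)]
    (hm : Function.Injective ((IsLocalRing.maximalIdeal A).subtype.lTensor B)) :
    Module.Flat A B := by
  rw [Module.Flat.iff_lTensor_injective']
  intro I
  rw [injective_iff_map_eq_zero]
  intro z hz
  set m := IsLocalRing.maximalIdeal A
  -- The kernel element `z` dies already in `B ⊗ (𝔪 ^ n + I)`, since that ideal contains a power of
  -- `𝔪`. The exact sequence `𝔪 ^ n ∩ I → I × 𝔪 ^ n → 𝔪 ^ n + I` then pulls it back to `B ⊗ (𝔪 ^ n ∩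
  -- I)`.
  have key : ∀ n : ℕ, ∃ w : B ⊗[A] (m ^ n • ⊤ ⊓ I : Ideal A),
      (Submodule.inclusion (inf_le_right : m ^ n • ⊤ ⊓ I ≤ I)).lTensor B w = z := by
    intro n
    have hJ := lTensor_subtype_injective_of_pow_le hm (m ^ n ⊔ I) ⟨n, le_sup_left⟩
    have hz' : (Submodule.inclusion (le_sup_right : I ≤ m ^ n ⊔ I)).lTensor B z = 0 := by
      apply hJ
      rw [map_zero, ← hz, ← LinearMap.comp_apply, ← LinearMap.lTensor_comp]
      rfl
    have H := exists_lTensor_eq_of_exact (B := B)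
      (Submodule.inclusion (inf_le_right : m ^ n • ⊤ ⊓ I ≤ I))
      (-Submodule.inclusion (inf_le_left.trans Ideal.mul_le_left : m ^ n • ⊤ ⊓ I ≤ m ^ n))
      (Submodule.inclusion (le_sup_right : I ≤ m ^ n ⊔ I))
      (Submodule.inclusion (le_sup_left : m ^ n ≤ m ^ n ⊔ I))
    refine (H ?_ ?_ z hz').imp fun w hw => hw.1
    · rintro ⟨⟨i, hi⟩, ⟨a, ha⟩⟩
      constructor
      · intro h
        have h' : i + a = 0 := congrArg Subtype.val h
        refine ⟨⟨i, ?_, hi⟩, ?_⟩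
        · rw [smul_eq_mul, Ideal.mul_top, eq_neg_of_add_eq_zero_left h']
          exact neg_mem ha
        · ext
          · rfl
          · change -i = a
            linear_combination -h'
      · rintro ⟨c, h⟩
        obtain ⟨h1, h2⟩ := Prod.ext_iff.1 h
        have h1 : (c : A) = i := congrArg Subtype.val h1
        have h2 : -(c : A) = a := congrArg Subtype.val h2
        ext
        change i + a = 0
        rw [← h1, ← h2]; ring
    · rintro ⟨x, hx⟩
      obtain ⟨a, ha, i, hi, h⟩ := Submodule.mem_sup.1 hx
      exact ⟨(⟨i, hi⟩, ⟨a, ha⟩), Subtype.ext ((add_comm i a).trans h)⟩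
  clear hz
  -- Artin–Rees: `𝔪 ^ (i + c) ∩ I ⊆ 𝔪 ^ i I`, so using `key` at `i + c` places `z` in the `i`-th
  -- step of the filtration of `B ⊗ I`.
  obtain ⟨c, hc⟩ := Ideal.exists_pow_inf_eq_pow_smul m I
  have hmem : z ∈ (⨅ i : ℕ, (m.map (algebraMap A B)) ^ i • (⊤ : Submodule B (B ⊗[A] I))) := by
    rw [Submodule.mem_iInf]
    intro i
    obtain ⟨w, rfl⟩ := key (i + c)
    refine lTensor_inclusion_mem_pow_smul m I _ i (fun a ha => ?_) w
    rw [hc _ (Nat.le_add_left c i), Nat.add_sub_cancel] at ha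
    exact Submodule.smul_mono le_rfl inf_le_right ha
  have hbot := Ideal.iInf_pow_smul_eq_bot_of_isLocalRing (M := B ⊗[A] I)
    (m.map (algebraMap A B)) (fun h => by
      have h' := ((IsLocalRing.local_hom_TFAE (algebraMap A B)).out 0 2).1 ‹_›
      rw [h, top_le_iff] at h'
      exact (IsLocalRing.maximalIdeal.isMaximal B).ne_top h')
  rw [hbot] at hmem
  exact hmem

/-- If `J ⊗ B → B` is injective and `x` is regular on `B / J B`, then `(J + x) ⊗ B → B` is
injective. -/
theorem lTensor_sup_span_injective [AddCommGroup B] [Module A B] (J : Ideal A) (x : A)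
    (hJ : Function.Injective (J.subtype.lTensor B))
    (hx : ∀ b : B, x • b ∈ J • (⊤ : Submodule A B) → b ∈ J • (⊤ : Submodule A B)) :
    Function.Injective ((J ⊔ Ideal.span {x}).subtype.lTensor B) := by
  have hJle : J ≤ J ⊔ Ideal.span {x} := le_sup_left
  have hxm : x ∈ J ⊔ Ideal.span {x} := Ideal.mem_sup_right (Ideal.mem_span_singleton_self x)
  let xx : (J ⊔ Ideal.span {x} : Ideal A) := ⟨x, hxm⟩
  let ι := (Submodule.inclusion hJle).lTensor B
  let ev : B ⊗[A] A →ₗ[A] B := (TensorProduct.rid A B).toLinearMap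
  have hmemJ : ∀ w : B ⊗[A] J, ev (J.subtype.lTensor B w) ∈ J • (⊤ : Submodule A B) := by
    intro w
    induction w using TensorProduct.induction_on with
    | zero => simp
    | add a b ha hb => rw [map_add, map_add]; exact add_mem ha hb
    | tmul b j => exact Submodule.smul_mem_smul j.2 trivial
  have hdec : ∀ z : B ⊗[A] (J ⊔ Ideal.span {x} : Ideal A), ∃ (w : B ⊗[A] J) (b : B),
      z = ι w + b ⊗ₜ xx := by
    intro z
    induction z using TensorProduct.induction_on with
    | zero => exact ⟨0, 0, by simp⟩
    | add z z' h h' =>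
      obtain ⟨w, b, rfl⟩ := h
      obtain ⟨w', b', rfl⟩ := h'
      exact ⟨w + w', b + b', by rw [map_add, TensorProduct.add_tmul]; abel⟩
    | tmul b y =>
      obtain ⟨y, hy⟩ := y
      obtain ⟨j, hj, c, hc, rfl⟩ := Submodule.mem_sup.1 hy
      obtain ⟨a, rfl⟩ := Ideal.mem_span_singleton'.1 hc
      refine ⟨b ⊗ₜ ⟨j, hj⟩, a • b, ?_⟩
      rw [TensorProduct.smul_tmul]
      change _ = b ⊗ₜ _ + _
      rw [← TensorProduct.tmul_add]
      rfl
  -- For `r ∈ J`, the element `r n ⊗ x` equals `x n ⊗ r`, which comes from `B ⊗ J`.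
  have hJB : ∀ b ∈ J • (⊤ : Submodule A B), ∃ w : B ⊗[A] J, b ⊗ₜ xx = ι w := by
    intro b hb
    induction hb using Submodule.smul_induction_on' with
    | smul r hr n hn =>
      refine ⟨(x • n) ⊗ₜ ⟨r, hr⟩, ?_⟩
      change _ = (x • n) ⊗ₜ _
      rw [TensorProduct.smul_tmul, TensorProduct.smul_tmul]
      congr 1
      exact Subtype.ext (mul_comm r x)
    | add a ha c hc iha ihc =>
      obtain ⟨w, hw⟩ := iha
      obtain ⟨w', hw'⟩ := ihc
      exact ⟨w + w', by rw [TensorProduct.add_tmul, hw, hw', map_add]⟩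
  have hι : ∀ w, (J ⊔ Ideal.span {x}).subtype.lTensor B (ι w) = J.subtype.lTensor B w := by
    intro w
    rw [← LinearMap.comp_apply, ← LinearMap.lTensor_comp]
    rfl
  rw [injective_iff_map_eq_zero]
  intro z hz
  obtain ⟨w, b, rfl⟩ := hdec z
  have h1 : ev (J.subtype.lTensor B w) + x • b = 0 := by
    have := congrArg ev hz
    rw [map_add, map_add, map_zero, hι] at this
    exact this
  have h2 : x • b ∈ J • (⊤ : Submodule A B) := by
    rw [eq_neg_of_add_eq_zero_right h1]
    exact neg_mem (hmemJ w)
  obtain ⟨w', hw'⟩ := hJB b (hx b h2)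
  rw [hw', ← map_add] at hz ⊢
  rw [hι] at hz
  rw [(injective_iff_map_eq_zero _).1 hJ _ hz, map_zero]

end LocalCriterion

/-! ### Regular local rings and regular sequences. -/

section RegularLocal

open IsLocalRing RingTheory.Sequence
open scoped Pointwise

/-- A parameter outside `𝔪²` can replace one of the given generators of `𝔪`. -/
theorem exists_span_insert_eq_maximalIdeal {A : Type*} [CommRing A] [IsLocalRing A] [DecidableEq A]
    (s : Finset A) (hs : Ideal.span (s : Set A) = maximalIdeal A) {x : A}
    (hx : x ∈ maximalIdeal A) (hx2 : x ∉ maximalIdeal A ^ 2) :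
    ∃ t : Finset A, t.card + 1 ≤ s.card ∧ Ideal.span ({x} ∪ (t : Set A)) = maximalIdeal A := by
  have hx' := hx
  rw [← hs] at hx'
  obtain ⟨a, ha⟩ := (Submodule.mem_span_finset' (R := A)).1 hx'
  -- If every coefficient of `x` lay in `𝔪`, then `x` would lie in `𝔪²`; a generator with unit
  -- coefficient is the one to exchange for `x`.
  have hu : ∃ i : s, IsUnit (a i) := by
    by_contra! h
    apply hx2
    rw [← ha, pow_two]
    refine sum_mem fun i _ => Ideal.mul_mem_mul (h i) ?_
    rw [← hs]
    exact Ideal.subset_span i.2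
  obtain ⟨i, hi⟩ := hu
  refine ⟨s.erase i, (Finset.card_erase_add_one i.2).le, le_antisymm ?_ ?_⟩
  · rw [Ideal.span_le]
    rintro y (rfl | hy)
    · exact hx
    · rw [← hs]
      exact Ideal.subset_span (Finset.mem_of_mem_erase hy)
  · have hle : ∀ j : s, j ≠ i → (j : A) ∈ Ideal.span ({x} ∪ ((s.erase i : Finset A) : Set A)) :=
      fun j hj => Ideal.subset_span (Or.inr (Finset.mem_erase.2
        ⟨fun h => hj (Subtype.ext h), j.2⟩))
    rw [← hs, Ideal.span_le]
    intro y hy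
    by_cases hyi : (⟨y, hy⟩ : s) = i
    · rw [SetLike.mem_coe, ← Ideal.unit_mul_mem_iff_mem _ hi]
      have h1 : x - ∑ j ∈ (Finset.univ.erase i), a j • (j : A) = a i * i := by
        rw [← ha, ← Finset.add_sum_erase _ _ (Finset.mem_univ i)]
        simp
      have h2 : a i * y = a i * i := by rw [← hyi]
      rw [h2, ← h1]
      refine sub_mem (Ideal.subset_span (Or.inl rfl)) (sum_mem fun j hj => ?_)
      exact Ideal.mul_mem_left _ _ (hle j (Finset.ne_of_mem_erase hj))
    · exact hle ⟨y, hy⟩ hyi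

/-- Exchanging `x` for a minimal generator leaves at most `d` generators modulo `x`, while the
dimension drops by at most one, hence stays at least `d`. As dimension never exceeds the number of
generators, both equal `d`. -/
theorem regularLocalRing_quotient_span_singleton {A : Type*} [CommRing A] [IsRegularLocalRing A]
    {x : A} (hx : x ∈ maximalIdeal A) (hx2 : x ∉ maximalIdeal A ^ 2) {d : ℕ}
    (hd : (maximalIdeal A).spanFinrank = d + 1) :
    ∃ _ : IsRegularLocalRing (A ⧸ Ideal.span {x}),
      (maximalIdeal (A ⧸ Ideal.span {x})).spanFinrank = d := by
  classical
  have hlt : Ideal.span {x} ≤ maximalIdeal A := by simpa [Ideal.span_le] using hx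
  have : Nontrivial (A ⧸ Ideal.span {x}) := Ideal.Quotient.nontrivial_iff.2
    (fun h => (maximalIdeal.isMaximal A).ne_top (top_le_iff.1 (h ▸ hlt)))
  have : IsLocalRing (A ⧸ Ideal.span {x}) :=
    IsLocalRing.of_surjective' _ Ideal.Quotient.mk_surjective
  have hm := map_maximalIdeal_of_surjective _ (Ideal.Quotient.mk_surjective (I := Ideal.span {x}))
  obtain ⟨s, hs1, hs2⟩ :=
    Submodule.FG.exists_span_finset_card_eq_spanFinrank (maximalIdeal A).fg_of_isNoetherianRing
  obtain ⟨t, ht1, ht2⟩ := exists_span_insert_eq_maximalIdeal s hs2 hx hx2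
  have h1 : (maximalIdeal (A ⧸ Ideal.span {x})).spanFinrank ≤ d := by
    have : maximalIdeal (A ⧸ Ideal.span {x}) =
        Ideal.span ((t.image (Ideal.Quotient.mk (Ideal.span {x})) : Finset _) : Set _) := by
      rw [← hm, ← ht2, Ideal.map_span, Set.image_union, Ideal.span_union, Set.image_singleton,
        Ideal.Quotient.eq_zero_iff_mem.2 (Ideal.mem_span_singleton_self x), Finset.coe_image]
      simp
    rw [this]
    refine (Submodule.spanFinrank_span_le_ncard_of_finite (Finset.finite_toSet _)).trans ?_
    rw [Set.ncard_coe_finset]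
    have := Finset.card_image_le (s := t) (f := Ideal.Quotient.mk (Ideal.span {x}))
    omega
  have h2 : ringKrullDim A ≤ ringKrullDim (A ⧸ Ideal.span {x}) + 1 := by
    have := ringKrullDim_le_ringKrullDim_quotient_add_card ({x} : Finset A) (by
      rw [IsLocalRing.ringJacobson_eq_maximalIdeal]; simpa using hx)
    rwa [Finset.coe_singleton, Finset.card_singleton, Nat.cast_one] at this
  rw [← IsRegularLocalRing.spanFinrank_maximalIdeal, hd] at h2
  have h3 := ringKrullDim_le_spanFinrank_maximalIdeal (A ⧸ Ideal.span {x})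
  have h4 : ((d + 1 : ℕ) : WithBot ℕ∞) ≤
      (((maximalIdeal (A ⧸ Ideal.span {x})).spanFinrank + 1 : ℕ) : WithBot ℕ∞) := by
    refine h2.trans ?_
    push_cast
    gcongr
  have h5 : d + 1 ≤ (maximalIdeal (A ⧸ Ideal.span {x})).spanFinrank + 1 := by exact_mod_cast h4
  have h6 : (maximalIdeal (A ⧸ Ideal.span {x})).spanFinrank = d := by omega
  refine ⟨IsRegularLocalRing.of_spanFinrank_maximalIdeal_le _ ?_, h6⟩
  rw [h6]
  by_contra! hlt'
  have : ringKrullDim (A ⧸ Ideal.span {x}) + 1 < ((d + 1 : ℕ) : WithBot ℕ∞) := by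
    have h0 : ringKrullDim (A ⧸ Ideal.span {x}) ≠ ⊥ := ringKrullDim_ne_bot
    obtain ⟨n, hn⟩ := WithBot.ne_bot_iff_exists.1 h0
    rw [← hn] at hlt' ⊢
    have h7 : n < (d : ℕ∞) := by exact_mod_cast hlt'
    have h8 : n ≠ ⊤ := h7.ne_top
    lift n to ℕ using h8
    have h9 : n < d := by exact_mod_cast h7
    exact_mod_cast Nat.succ_lt_succ h9
  exact absurd h2 (not_le.2 this)

/-- Prime avoidance for `𝔪²` and the finitely many minimal primes: `𝔪 = 𝔪²` would force `𝔪 = 0` by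
Nakayama, and `𝔪` minimal would force dimension zero, both incompatible with `d + 1`. -/
theorem exists_parameter {A : Type*} [CommRing A] [IsRegularLocalRing A] {d : ℕ}
    (hd : (maximalIdeal A).spanFinrank = d + 1) :
    ∃ x ∈ maximalIdeal A, x ∉ maximalIdeal A ^ 2 ∧ ∀ P ∈ minimalPrimes A, x ∉ P := by
  classical
  have hfin : (minimalPrimes A).Finite := minimalPrimes.finite_of_isNoetherianRing A
  by_contra! hcon
  have hsub : ((maximalIdeal A : Ideal A) : Set A) ⊆
      ⋃ I ∈ ((insert (maximalIdeal A ^ 2) hfin.toFinset : Finset (Ideal A)) : Set (Ideal A)),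
        ((id I : Ideal A) : Set A) := by
    intro x hx
    by_cases h2 : x ∈ maximalIdeal A ^ 2
    · exact Set.mem_biUnion (Finset.mem_coe.2 (Finset.mem_insert_self _ _)) h2
    · obtain ⟨P, hP, hxP⟩ := hcon x hx h2
      exact Set.mem_biUnion (Finset.mem_coe.2 (Finset.mem_insert_of_mem (hfin.mem_toFinset.2 hP)))
        hxP
  -- Prime avoidance tolerates two ideals that need not be prime; both places are given to `𝔪²`.
  rw [Ideal.subset_union_prime (maximalIdeal A ^ 2) (maximalIdeal A ^ 2)] at hsub
  · obtain ⟨I, hI, hle⟩ := hsub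
    rw [id] at hle
    rcases Finset.mem_insert.1 hI with rfl | hI
    · have : maximalIdeal A = ⊥ := by
        apply Submodule.eq_bot_of_le_smul_of_le_jacobson_bot (maximalIdeal A) _
          ((maximalIdeal A).fg_of_isNoetherianRing)
        · rwa [pow_two] at hle
        · exact maximalIdeal_le_jacobson _
      rw [this, Submodule.spanFinrank_bot] at hd
      omega
    · rw [Set.Finite.mem_toFinset] at hI
      have hprime := Ideal.IsMinimalPrime.isPrime hI
      have : I = maximalIdeal A := le_antisymm (le_maximalIdeal hprime.ne_top) hle
      subst this
      have h0 : (maximalIdeal A).height = 0 := by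
        exact Ideal.height_eq_zero_iff.2 hI
      have h1 := IsLocalRing.maximalIdeal_height_eq_ringKrullDim (R := A)
      rw [h0, ← IsRegularLocalRing.spanFinrank_maximalIdeal, hd] at h1
      have : (0 : ℕ) = d + 1 := by exact_mod_cast h1
      omega
  · intro I hI h1 _
    rcases Finset.mem_insert.1 hI with rfl | hI
    · exact absurd rfl h1
    · exact Ideal.IsMinimalPrime.isPrime (hfin.mem_toFinset.1 hI)

/-- A regular local ring is a domain whose maximal ideal is generated by a regular sequence. -/
theorem isDomain_and_exists_regular_sequence (d : ℕ) : ∀ (A : Type*) [CommRing A]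
    [IsRegularLocalRing A], (maximalIdeal A).spanFinrank = d →
      IsDomain A ∧ ∃ rs : List A, IsWeaklyRegular A rs ∧ Ideal.ofList rs = maximalIdeal A := by
  induction d with
  | zero =>
    intro A _ _ hd
    have hm : maximalIdeal A = ⊥ :=
      (Submodule.spanFinrank_eq_zero_iff_eq_bot (maximalIdeal A).fg_of_isNoetherianRing).1 hd
    exact ⟨((isField_iff_maximalIdeal_eq).2 hm).isDomain, [], .nil _ _, by rw [hm]; simp⟩
  | succ d ih =>
    intro A _ _ hd
    obtain ⟨x, hx, hx2, hxP⟩ := exists_parameter hd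
    obtain ⟨_, hd'⟩ := regularLocalRing_quotient_span_singleton hx hx2 hd
    obtain ⟨hdom, rs, hrs, hrm⟩ := ih (A ⧸ Ideal.span {x}) hd'
    have hprime : (Ideal.span {x}).IsPrime := (Ideal.Quotient.isDomain_iff_prime _).1 hdom
    have hA : IsDomain A := by
      obtain ⟨P, hP, hle⟩ := Ideal.exists_minimalPrimes_le (bot_le : ⊥ ≤ Ideal.span {x})
      have hPp := Ideal.IsMinimalPrime.isPrime hP
      -- An element of `P ⊆ (x)` is `a x` with `x ∉ P`, so `a ∈ P` and `P ⊆ 𝔪 P`; Nakayama gives `P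
      -- = 0`.
      have hbot : P = ⊥ := by
        apply Submodule.eq_bot_of_le_smul_of_le_jacobson_bot (maximalIdeal A) _
          P.fg_of_isNoetherianRing
        · intro y hy
          obtain ⟨a, rfl⟩ := Ideal.mem_span_singleton'.1 (hle hy)
          have := (hPp.mem_or_mem hy).resolve_right (hxP P hP)
          rw [mul_comm]
          exact Ideal.mul_mem_mul hx this
        · exact maximalIdeal_le_jacobson _
      rw [hbot] at hPp
      exact IsDomain.of_bot_isPrime A
    refine ⟨hA, ?_⟩
    have hx0 : x ≠ 0 := fun h => hx2 (h ▸ zero_mem _)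
    obtain ⟨ss, rfl⟩ := List.map_surjective_iff.2
      (Ideal.Quotient.mk_surjective (I := Ideal.span {x})) rs
    refine ⟨x :: ss, ?_, ?_⟩
    · rw [isWeaklyRegular_cons_iff]
      refine ⟨IsSMulRegular.of_ne_zero hx0, ?_⟩
      have h1 := (isWeaklyRegular_map_algebraMap_iff (A ⧸ Ideal.span {x})
        (A ⧸ Ideal.span {x}) ss).1 hrs
      have he : Ideal.span {x} = x • (⊤ : Ideal A) := by
        rw [← Submodule.ideal_span_singleton_smul]; simp
      exact ((Submodule.quotEquivOfEq _ _ he).isWeaklyRegular_congr ss).1 h1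
    · have hm := map_maximalIdeal_of_surjective _
        (Ideal.Quotient.mk_surjective (I := Ideal.span {x}))
      rw [Ideal.ofList_cons]
      rw [← Ideal.map_ofList, ← hm] at hrm
      have := congrArg (Ideal.comap (Ideal.Quotient.mk (Ideal.span {x}))) hrm
      rw [Ideal.comap_map_of_surjective' _ Ideal.Quotient.mk_surjective,
        Ideal.comap_map_of_surjective' _ Ideal.Quotient.mk_surjective, Ideal.mk_ker] at this
      rw [sup_comm, this, sup_eq_left]
      simpa [Ideal.span_le] using hx

/-- Powers of a regular sequence in a local ring form a regular sequence. -/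
theorem isWeaklyRegular_map_pow {A : Type*} [CommRing A] [IsLocalRing A] [IsNoetherianRing A]
    {n : ℕ} (hn : n ≠ 0) (rs : List A) : ∀ (ts : List A),
    IsWeaklyRegular A (rs ++ ts) → (∀ r ∈ rs ++ ts, r ∈ maximalIdeal A) →
      IsWeaklyRegular A (rs.map (· ^ n) ++ ts) := by
  induction rs with
  | nil => intro ts h _; exact h
  | cons r rs ih =>
    intro ts h hm
    have hp : List.Perm (r :: rs ++ ts) ((rs ++ ts) ++ [r]) := by
      rw [List.cons_append]; exact (List.perm_append_singleton r (rs ++ ts)).symm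
    -- Regular sequences in a noetherian local ring may be permuted, so `r` is moved to the last
    -- place, where replacing it by `r ^ n` is harmless. The induction then continues with `r ^ n`
    -- in the untouched tail.
    have h1 := isWeaklyRegular_of_perm_of_subset_maximalIdeal h hp hm
    rw [isWeaklyRegular_append_iff, isWeaklyRegular_singleton_iff] at h1
    have h2 : IsWeaklyRegular A ((rs ++ ts) ++ [r ^ n]) := by
      rw [isWeaklyRegular_append_iff, isWeaklyRegular_singleton_iff]
      exact ⟨h1.1, h1.2.pow n⟩
    rw [List.append_assoc] at h2
    have hrm : r ∈ maximalIdeal A := hm r (by simp)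
    have h3 := ih _ h2 (fun a ha => by
      simp only [List.mem_append, List.mem_singleton] at ha
      rcases ha with ha | ha | rfl
      · exact hm a (by simp [ha])
      · exact hm a (by simp [ha])
      · exact Ideal.pow_mem_of_mem _ hrm n (Nat.pos_of_ne_zero hn))
    refine isWeaklyRegular_of_perm_of_subset_maximalIdeal h3 ?_ ?_
    · rw [← List.append_assoc, List.map_cons, List.cons_append]
      exact List.perm_append_singleton _ _
    · intro a ha
      simp only [List.mem_append, List.mem_singleton, List.mem_map] at ha
      rcases ha with ⟨b, hb, rfl⟩ | ha | rfl
      · exact Ideal.pow_mem_of_mem _ (hm b (by simp [hb])) n (Nat.pos_of_ne_zero hn)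
      · exact hm a (by simp [ha])
      · exact Ideal.pow_mem_of_mem _ hrm n (Nat.pos_of_ne_zero hn)

end RegularLocal

/-! ### Kunz's theorem: flatness of Frobenius on a regular ring. -/

section Kunz

open IsLocalRing RingTheory.Sequence

/-- The ideal is built up by adding the terms of the sequence at the end, one at a time; regularity
of each term modulo the previous ones is what `lTensor_sup_span_injective` requires. -/
theorem lTensor_ofList_injective {A B : Type*} [CommRing A] [AddCommGroup B] [Module A B]
    (rs : List A) (h : IsWeaklyRegular B rs) :
    Function.Injective ((Ideal.ofList rs).subtype.lTensor B) := by
  induction rs using List.reverseRecOn with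
  | nil =>
    rw [Ideal.ofList_nil]
    exact Function.injective_of_subsingleton _
  | append_singleton rs x ih =>
    rw [isWeaklyRegular_append_iff, isWeaklyRegular_singleton_iff] at h
    rw [Ideal.ofList_append, Ideal.ofList_singleton]
    refine lTensor_sup_span_injective _ x (ih h.1) (fun b hb => ?_)
    rw [← Submodule.Quotient.mk_eq_zero] at hb ⊢
    rw [Submodule.Quotient.mk_smul] at hb
    exact h.2 (hb.trans (smul_zero x).symm)

/-- Kunz's theorem for a regular local ring. -/
theorem flat_frobTwist_of_isRegularLocalRing (A : Type*) [CommRing A] [IsRegularLocalRing A]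
    (p e : ℕ) [ExpChar A p] : Module.Flat A (FrobTwist A p e) := by
  have hq : p ^ e ≠ 0 := pow_ne_zero _ (expChar_pos A p).ne'
  have : IsNoetherianRing (FrobTwist A p e) := inferInstanceAs (IsNoetherianRing A)
  have : IsLocalRing (FrobTwist A p e) := inferInstanceAs (IsLocalRing A)
  have : IsLocalHom (algebraMap A (FrobTwist A p e)) := by
    constructor
    intro a ha
    have ha : IsUnit (a ^ p ^ e) := ha
    exact (isUnit_pow_iff hq).1 ha
  apply flat_of_lTensor_maximalIdeal_injective
  obtain ⟨-, rs, hrs, hm⟩ := isDomain_and_exists_regular_sequence _ A rfl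
  have hmem : ∀ r ∈ rs, r ∈ maximalIdeal A := fun r hr => hm ▸ Ideal.subset_span hr
  rw [← hm]
  apply lTensor_ofList_injective
  -- The sequence `rs` acts on the twisted module as its `p ^ e`-th powers act on `A`.
  have h := isWeaklyRegular_map_pow hq rs [] (by simpa using hrs) (by simpa using hmem)
  rw [List.append_nil] at h
  refine (AddEquiv.isWeaklyRegular_congr (e := (FrobTwist.toRing A p e).toAddEquiv) ?_).2 h
  rw [List.forall₂_map_right_iff, List.forall₂_same]
  intro r _ x
  exact FrobTwist.toRing_smul r x

theorem expChar_localization (R : Type*) [CommRing R] (p : ℕ) [Fact p.Prime] [CharP R p]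
    (P : Ideal R) [P.IsPrime] : ExpChar (Localization.AtPrime P) p := by
  have : CharP (Localization.AtPrime P) p := by
    rw [CharP.charP_iff_prime_eq_zero Fact.out, ← map_natCast (algebraMap R _), CharP.cast_eq_zero,
      map_zero]
  exact ExpChar.prime Fact.out

/-- The localization of `R^e` at `P` is `(R_P)^e`, which is flat over `R_P` by the local case and
hence over `R`. -/
theorem flat_localizedModule_frobTwist (R : Type*) [CommRing R] [IsRegularRing R] (p e : ℕ)
    [Fact p.Prime] [CharP R p] [ExpChar R p] (P : Ideal R) [P.IsPrime] :
    Module.Flat R (LocalizedModule P.primeCompl (FrobTwist R p e)) := by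
  let L := Localization.AtPrime P
  have hL : ExpChar L p := expChar_localization R p P
  let _ : Module R (FrobTwist L p e) := Module.compHom _ (algebraMap R L)
  have : IsScalarTower R L (FrobTwist L p e) := ⟨fun r a x => by
    change (r • a) • x = (algebraMap R L r) • (a • x)
    rw [show r • a = algebraMap R L r * a from Algebra.smul_def r a]
    exact mul_smul _ _ _⟩
  let f : FrobTwist R p e →ₗ[R] FrobTwist L p e :=
    { toFun := fun x => algebraMap R L (FrobTwist.toRing R p e x)
      map_add' := map_add (algebraMap R L)
      map_smul' := fun r x => by
        rw [FrobTwist.toRing_smul, map_mul, map_pow]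
        rfl }
  have : IsLocalizedModule P.primeCompl f := by
    have hunit : ∀ s : P.primeCompl, IsUnit (algebraMap R L s ^ p ^ e) := fun s =>
      (IsLocalization.map_units L s).pow _
    refine ⟨fun s => ?_, fun y => ?_, fun {x y} h => ?_⟩
    · rw [Module.End.isUnit_iff]
      constructor
      · intro x y h
        exact (hunit s).mul_left_cancel h
      · intro y
        obtain ⟨x, hx⟩ := (hunit s).dvd (a := (show L from y))
        exact ⟨x, hx.symm⟩
    · obtain ⟨⟨a, s⟩, h⟩ := IsLocalization.surj P.primeCompl (show L from y)
      have hq : p ^ e = (p ^ e - 1) + 1 :=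
        (Nat.sub_add_cancel (Nat.one_le_iff_ne_zero.2
          (pow_ne_zero _ (Fact.out : p.Prime).ne_zero))).symm
      -- Here `s` acts as `s ^ p ^ e`, so the fraction `a / s` has to be expanded by `s ^ (p ^ e -
      -- 1)`.
      refine ⟨⟨(s : R) ^ (p ^ e - 1) * a, s⟩, ?_⟩
      change algebraMap R L s ^ p ^ e * (show L from y) =
        algebraMap R L ((s : R) ^ (p ^ e - 1) * a)
      rw [map_mul, map_pow, ← h, hq, pow_succ, Nat.add_sub_cancel]
      ring
    · obtain ⟨c, hc⟩ := IsLocalization.exists_of_eq (M := P.primeCompl) (S := L) h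
      refine ⟨c, ?_⟩
      change (c : R) ^ p ^ e * (show R from x) = (c : R) ^ p ^ e * (show R from y)
      obtain ⟨n, hn⟩ := Nat.exists_eq_succ_of_ne_zero
        (pow_ne_zero e (Fact.out : p.Prime).ne_zero)
      rw [hn, pow_succ, mul_assoc, mul_assoc]
      exact congrArg _ hc
  have : Module.Flat L (FrobTwist L p e) := flat_frobTwist_of_isRegularLocalRing L p e
  have : Module.Flat R (FrobTwist L p e) := Module.Flat.trans R L _
  exact Module.Flat.of_linearEquiv (IsLocalizedModule.iso P.primeCompl f)

/-- Kunz's theorem: the Frobenius of a regular ring is flat. -/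
theorem flat_frobTwist (R : Type*) [CommRing R] [IsRegularRing R] (p e : ℕ) [Fact p.Prime]
    [CharP R p] [ExpChar R p] : Module.Flat R (FrobTwist R p e) :=
  Module.flat_of_localized_maximal _ fun P _ => flat_localizedModule_frobTwist R p e P

end Kunz

/-! ### Flatness of Frobenius on `K ⊗ R`. -/

section FlatBaseChange

/-- `X^e` as an algebra over a base ring `k` of `X`, through the twisted structure. -/
abbrev frobTwistAlgebra (k X : Type*) [CommRing k] [CommRing X] [Algebra k X] (p e : ℕ)
    [ExpChar X p] : Algebra k (FrobTwist X p e) :=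
  ((algebraMap X (FrobTwist X p e)).comp (algebraMap k X)).toAlgebra

variable (k K R : Type*) [Field k] [IsAlgClosed k] [Field K] [Algebra k K] [CommRing R]
  [Algebra k R]

/-- Let `k` act on `K^e` and `R^e` through `p ^ e`-th powers. Because `k` is perfect, `K^e ⊗ R^e` is
the ring `(K ⊗ R)^e`, and its Frobenius becomes the tensor product of two flat maps: that of the
field `K` and that of `R`. -/
theorem flat_frobTwist_tensorProduct (p e : ℕ) [Fact p.Prime] [ExpChar R p]
    [Module.Flat R (FrobTwist R p e)] : Module.Flat (K ⊗[k] R) (FrobTwist (K ⊗[k] R) p e) := by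
  have hK : ExpChar K p := expChar_ext k K R p
  let _ := frobTwistAlgebra k K p e
  let _ := frobTwistAlgebra k R p e
  let _ := frobTwistAlgebra k (K ⊗[k] R) p e
  let φK : K →ₐ[k] FrobTwist K p e := ⟨algebraMap K (FrobTwist K p e), fun _ => rfl⟩
  let φR : R →ₐ[k] FrobTwist R p e := ⟨algebraMap R (FrobTwist R p e), fun _ => rfl⟩
  have hφK : φK.toRingHom.Flat := by
    change (algebraMap K (FrobTwist K p e)).Flat
    rw [RingHom.flat_algebraMap_iff]
    infer_instance
  have hφR : φR.toRingHom.Flat := by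
    change (algebraMap R (FrobTwist R p e)).Flat
    rw [RingHom.flat_algebraMap_iff]
    infer_instance
  let iK : FrobTwist K p e →ₐ[k] FrobTwist (K ⊗[k] R) p e :=
    ⟨(FrobTwist.toRing (K ⊗[k] R) p e).symm.toRingHom.comp
      ((Algebra.TensorProduct.includeLeft : K →ₐ[k] K ⊗[k] R).toRingHom.comp
        (FrobTwist.toRing K p e).toRingHom), fun c => by
      change ((algebraMap k K c) ^ p ^ e) ⊗ₜ[k] (1 : R) =
        ((algebraMap k K c) ⊗ₜ[k] (1 : R)) ^ p ^ e
      rw [Algebra.TensorProduct.tmul_pow, one_pow]⟩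
  let iR : FrobTwist R p e →ₐ[k] FrobTwist (K ⊗[k] R) p e :=
    ⟨(FrobTwist.toRing (K ⊗[k] R) p e).symm.toRingHom.comp
      ((Algebra.TensorProduct.includeRight : R →ₐ[k] K ⊗[k] R).toRingHom.comp
        (FrobTwist.toRing R p e).toRingHom), fun c => by
      change (1 : K) ⊗ₜ[k] ((algebraMap k R c) ^ p ^ e) =
        ((algebraMap k K c) ⊗ₜ[k] (1 : R)) ^ p ^ e
      rw [← Algebra.TensorProduct.algebraMap_apply, Algebra.TensorProduct.algebraMap_apply',
        Algebra.TensorProduct.tmul_pow, one_pow]⟩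
  let ψ := Algebra.TensorProduct.productMap iK iR
  have hψ : ∀ (a : K) (r : R), ψ ((FrobTwist.toRing K p e).symm a ⊗ₜ
      (FrobTwist.toRing R p e).symm r) = (FrobTwist.toRing (K ⊗[k] R) p e).symm (a ⊗ₜ r) := by
    intro a r
    change (a ⊗ₜ[k] (1 : R)) * ((1 : K) ⊗ₜ[k] r) = a ⊗ₜ[k] r
    rw [Algebra.TensorProduct.tmul_mul_tmul, mul_one, one_mul]
  let χ : K ⊗[k] R →+ FrobTwist K p e ⊗[k] FrobTwist R p e := TensorProduct.liftAddHom
    (AddMonoidHom.mk' (fun a => AddMonoidHom.mk' (fun r => (FrobTwist.toRing K p e).symm a ⊗ₜ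
      (FrobTwist.toRing R p e).symm r) (fun r s => by rw [map_add, TensorProduct.tmul_add]))
      (fun a b => by ext r; exact TensorProduct.add_tmul _ _ _))
    (fun c a r => by
      -- The inverse of `ψ` is balanced over `k` because each scalar is a `p ^ e`-th power, so it
      -- acts as an element of `k` in the twisted structure.
      obtain ⟨d, rfl⟩ := IsAlgClosed.exists_pow_nat_eq c (pow_pos (Fact.out : p.Prime).pos e)
      have h1 : (FrobTwist.toRing K p e).symm (d ^ p ^ e • a) =
          d • (FrobTwist.toRing K p e).symm a := by
        change d ^ p ^ e • a = (algebraMap k K d) ^ p ^ e * a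
        rw [Algebra.smul_def, map_pow]
      have h2 : (FrobTwist.toRing R p e).symm (d ^ p ^ e • r) =
          d • (FrobTwist.toRing R p e).symm r := by
        change d ^ p ^ e • r = (algebraMap k R d) ^ p ^ e * r
        rw [Algebra.smul_def, map_pow]
      change (FrobTwist.toRing K p e).symm (d ^ p ^ e • a) ⊗ₜ[k] (FrobTwist.toRing R p e).symm r =
        (FrobTwist.toRing K p e).symm a ⊗ₜ[k] (FrobTwist.toRing R p e).symm (d ^ p ^ e • r)
      rw [h1, h2, TensorProduct.smul_tmul])
  have hbij : Function.Bijective ψ := by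
    rw [Function.bijective_iff_has_inverse]
    refine ⟨fun x => χ (FrobTwist.toRing _ p e x), fun x => ?_, fun x => ?_⟩
    · beta_reduce
      induction x using TensorProduct.induction_on with
      | zero => rw [map_zero, map_zero, map_zero]
      | add x y hx hy => rw [map_add, map_add, map_add, hx, hy]
      | tmul a r =>
        have := hψ (FrobTwist.toRing K p e a) (FrobTwist.toRing R p e r)
        rw [RingEquiv.symm_apply_apply, RingEquiv.symm_apply_apply] at this
        rw [this, RingEquiv.apply_symm_apply]
        rfl
    · obtain ⟨x, rfl⟩ := (FrobTwist.toRing (K ⊗[k] R) p e).symm.surjective x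
      beta_reduce
      rw [RingEquiv.apply_symm_apply]
      induction x using TensorProduct.induction_on with
      | zero => rw [map_zero, map_zero, map_zero]
      | add x y hx hy => rw [map_add, map_add, map_add, hx, hy]
      | tmul a r => exact hψ a r
  have hcomp : algebraMap (K ⊗[k] R) (FrobTwist (K ⊗[k] R) p e) =
      ψ.toRingHom.comp (Algebra.TensorProduct.map φK φR).toRingHom := by
    refine RingHom.ext fun x => ?_
    induction x using TensorProduct.induction_on with
    | zero => rw [map_zero, map_zero]
    | add x y hx hy => rw [map_add, map_add, hx, hy]
    | tmul a r =>
      have := hψ (a ^ p ^ e) (r ^ p ^ e)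
      refine Eq.trans ?_ this.symm
      rw [← Algebra.TensorProduct.tmul_pow]
      rfl
  rw [← RingHom.flat_algebraMap_iff, hcomp]
  exact (RingHom.Flat.tensorProductMap hφK hφR).comp (RingHom.Flat.of_bijective hbij)

end FlatBaseChange

/-! ### Unit modules under extension of the base field. -/

section UnitBaseChange

variable {k K R M : Type*} [Field k] [Field K] [Algebra k K] [CommRing R] [Algebra k R]
  [AddCommGroup M] [Module k M] [Module R M] [IsScalarTower k R M] {p e : ℕ} [ExpChar R p]

variable (k K R M p e) in
/-- The additive map `(r ⊗ m) ↦ (a ⊗ r) ⊗ (1 ⊗ m)`. -/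
def pullbackIncl (a : K) : Pullback R p e M →+ Pullback (K ⊗[k] R) p e (K ⊗[k] M) :=
  TensorProduct.liftAddHom
    (AddMonoidHom.mk' (fun r => AddMonoidHom.mk'
      (fun m => (FrobTwist.toRing (K ⊗[k] R) p e).symm (a ⊗ₜ[k] FrobTwist.toRing R p e r)
        ⊗ₜ[K ⊗[k] R] ((1 : K) ⊗ₜ[k] m))
      (fun m n => by rw [TensorProduct.tmul_add, TensorProduct.tmul_add]))
      (fun r s => by
        ext m
        change _ ⊗ₜ[K ⊗[k] R] _ = _ ⊗ₜ[K ⊗[k] R] _ + _ ⊗ₜ[K ⊗[k] R] _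
        rw [← TensorProduct.add_tmul, map_add, TensorProduct.tmul_add, map_add]))
    (fun s r m => by
      have h1 : (FrobTwist.toRing (K ⊗[k] R) p e).symm (a ⊗ₜ[k] FrobTwist.toRing R p e (s • r)) =
          ((1 : K) ⊗ₜ[k] s) • (FrobTwist.toRing (K ⊗[k] R) p e).symm
            (a ⊗ₜ[k] FrobTwist.toRing R p e r) := by
        apply (FrobTwist.toRing (K ⊗[k] R) p e).injective
        rw [FrobTwist.toRing_smul, FrobTwist.toRing_smul, RingEquiv.apply_symm_apply,
          RingEquiv.apply_symm_apply, Algebra.TensorProduct.tmul_pow,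
          Algebra.TensorProduct.tmul_mul_tmul, one_pow, one_mul]
      have h2 : ((1 : K) ⊗ₜ[k] (s • m)) = ((1 : K) ⊗ₜ[k] s) • ((1 : K) ⊗ₜ[k] m) := by
        rw [tmul_smul_tmul, one_mul]
      change (FrobTwist.toRing (K ⊗[k] R) p e).symm (a ⊗ₜ[k] FrobTwist.toRing R p e (s • r))
        ⊗ₜ[K ⊗[k] R] _ = _ ⊗ₜ[K ⊗[k] R] ((1 : K) ⊗ₜ[k] (s • m))
      rw [h1, h2, TensorProduct.smul_tmul])

theorem pullbackIncl_tmul (a : K) (r : FrobTwist R p e) (m : M) :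
    pullbackIncl k K R M p e a (r ⊗ₜ m) = (FrobTwist.toRing (K ⊗[k] R) p e).symm
      (a ⊗ₜ[k] FrobTwist.toRing R p e r) ⊗ₜ[K ⊗[k] R] ((1 : K) ⊗ₜ[k] m) := rfl

theorem pullbackIncl_add (a b : K) (t : Pullback R p e M) :
    pullbackIncl k K R M p e (a + b) t =
      pullbackIncl k K R M p e a t + pullbackIncl k K R M p e b t := by
  induction t using TensorProduct.induction_on with
  | zero => simp
  | add x y hx hy => rw [map_add, map_add, map_add, hx, hy]; abel
  | tmul r m =>
    rw [pullbackIncl_tmul, pullbackIncl_tmul, pullbackIncl_tmul, TensorProduct.add_tmul, map_add,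
      TensorProduct.add_tmul]

theorem pullbackIncl_smul (c : k) (a : K) (t : Pullback R p e M) :
    pullbackIncl k K R M p e (c • a) t =
      pullbackIncl k K R M p e a ((FrobTwist.toRing R p e).symm (algebraMap k R c) • t) := by
  induction t using TensorProduct.induction_on with
  | zero => simp
  | add x y hx hy => rw [map_add, smul_add, map_add, hx, hy]
  | tmul r m =>
    rw [TensorProduct.smul_tmul', pullbackIncl_tmul, pullbackIncl_tmul, smul_eq_mul, map_mul,
      RingEquiv.apply_symm_apply, ← Algebra.smul_def, TensorProduct.smul_tmul]

/-- Unit modules are stable under extension of the base field. -/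
theorem isUnitModule_baseChange {F : M →ₛₗ[iterateFrobenius R p e] M} (hF : IsUnitModule F) :
    IsUnitModule (baseChange (k := k) K F) := by
  constructor
  · let θ := Equiv.ofBijective (theta F) hF
    have hadd : ∀ x y, θ.symm (x + y) = θ.symm x + θ.symm y := fun x y => by
      apply θ.injective
      rw [Equiv.apply_symm_apply]
      change _ = theta F (_ + _)
      rw [map_add]
      exact congrArg₂ (· + ·) (θ.apply_symm_apply x).symm (θ.apply_symm_apply y).symm
    have hsmul : ∀ (c : k) m, θ.symm (c • m) =
        (FrobTwist.toRing R p e).symm (algebraMap k R c) • θ.symm m := fun c m => by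
      apply θ.injective
      rw [Equiv.apply_symm_apply]
      change _ = theta F (_ • _)
      rw [LinearMap.map_smulₛₗ]
      change _ = (algebraMap k R c) • θ (θ.symm m)
      rw [Equiv.apply_symm_apply, algebraMap_smul]
    -- A left inverse of the structure map, assembled from the inverse of `theta F` and the maps
    -- `pullbackIncl`.
    let Γ : K ⊗[k] M →+ Pullback (K ⊗[k] R) p e (K ⊗[k] M) := TensorProduct.liftAddHom
      (AddMonoidHom.mk' (fun a => AddMonoidHom.mk' (fun m => pullbackIncl k K R M p e a (θ.symm m))
        (fun m n => by rw [hadd, map_add]))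
        (fun a b => by ext m; exact pullbackIncl_add _ _ _))
      (fun c a m => by
        change pullbackIncl k K R M p e (c • a) (θ.symm m) =
          pullbackIncl k K R M p e a (θ.symm (c • m))
        rw [hsmul, pullbackIncl_smul])
    apply Function.LeftInverse.injective (g := Γ)
    intro t
    induction t using TensorProduct.induction_on with
    | zero => rw [map_zero, map_zero]
    | add x y hx hy => rw [map_add, map_add, hx, hy]
    | tmul x y =>
      obtain ⟨x, rfl⟩ := (FrobTwist.toRing (K ⊗[k] R) p e).symm.surjective x
      rw [theta_tmul, RingEquiv.apply_symm_apply]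
      induction y using TensorProduct.induction_on with
      | zero => rw [map_zero, smul_zero, map_zero, TensorProduct.tmul_zero]
      | add y z hy hz => rw [map_add, smul_add, map_add, hy, hz, TensorProduct.tmul_add]
      | tmul b m =>
        induction x using TensorProduct.induction_on with
        | zero => rw [zero_smul, map_zero, map_zero, TensorProduct.zero_tmul]
        | add x z hx hz => rw [add_smul, map_add, hx, hz, map_add, TensorProduct.add_tmul]
        | tmul a r =>
          rw [baseChange_tmul, tmul_smul_tmul]
          change pullbackIncl k K R M p e (a * b ^ p ^ e) (θ.symm (r • F m)) = _
          have h1 : θ.symm (r • F m) = (FrobTwist.toRing R p e).symm r ⊗ₜ m := by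
            rw [Equiv.symm_apply_eq]
            rfl
          rw [h1, pullbackIncl_tmul, RingEquiv.apply_symm_apply]
          have h2 : (FrobTwist.toRing (K ⊗[k] R) p e).symm ((a * b ^ p ^ e) ⊗ₜ[k] r) =
              (b ⊗ₜ[k] (1 : R)) • (FrobTwist.toRing (K ⊗[k] R) p e).symm (a ⊗ₜ[k] r) := by
            apply (FrobTwist.toRing (K ⊗[k] R) p e).injective
            rw [FrobTwist.toRing_smul, RingEquiv.apply_symm_apply, RingEquiv.apply_symm_apply,
              Algebra.TensorProduct.tmul_pow, Algebra.TensorProduct.tmul_mul_tmul, one_pow,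
              one_mul, mul_comm]
          rw [h2, TensorProduct.smul_tmul, tmul_smul_tmul, mul_one, one_smul]
  · intro y
    induction y using TensorProduct.induction_on with
    | zero => exact ⟨0, map_zero _⟩
    | add y z hy hz =>
      obtain ⟨s, rfl⟩ := hy
      obtain ⟨t, rfl⟩ := hz
      exact ⟨s + t, map_add _ _ _⟩
    | tmul a m =>
      obtain ⟨t, rfl⟩ := hF.2 m
      refine ⟨pullbackIncl k K R M p e a t, ?_⟩
      induction t using TensorProduct.induction_on with
      | zero => simp
      | add x y hx hy => rw [map_add, map_add, map_add, TensorProduct.tmul_add, hx, hy]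
      | tmul r m =>
        rw [pullbackIncl_tmul, theta_tmul, theta_tmul, RingEquiv.apply_symm_apply,
          baseChange_tmul, tmul_smul_tmul, one_pow, mul_one]

end UnitBaseChange

/-! ### Frobenius transforms of submodules, and roots. -/

section Root

variable {R : Type*} [CommRing R] {p : ℕ} [ExpChar R p] {e : ℕ} {M : Type*} [AddCommGroup M]
  [Module R M] (F : M →ₛₗ[iterateFrobenius R p e] M)

/-- The `R`-submodule generated by `F X`. -/
def frobSpan (X : Submodule R M) : Submodule R M := Submodule.span R (F '' X)

variable {F}

theorem apply_mem_frobSpan {X : Submodule R M} {x : M} (hx : x ∈ X) : F x ∈ frobSpan F X :=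
  Submodule.subset_span ⟨x, hx, rfl⟩

theorem frobSpan_mono : Monotone (frobSpan F) := fun _ _ h =>
  Submodule.span_mono (Set.image_mono h)

theorem frobSpan_le_iff {X Y : Submodule R M} : frobSpan F X ≤ Y ↔ ∀ x ∈ X, F x ∈ Y := by
  rw [frobSpan, Submodule.span_le, Set.image_subset_iff]
  rfl

theorem theta_lTensor_subtype_mem (X : Submodule R M) (z : FrobTwist R p e ⊗[R] X) :
    theta F (X.subtype.lTensor _ z) ∈ frobSpan F X := by
  induction z using TensorProduct.induction_on with
  | zero => rw [map_zero, map_zero]; exact zero_mem _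
  | add x y hx hy => rw [map_add, map_add]; exact add_mem hx hy
  | tmul r x =>
    rw [LinearMap.lTensor_tmul, theta_tmul]
    exact Submodule.smul_mem _ _ (apply_mem_frobSpan x.2)

/-- The span of `F X` is the image of `R^e ⊗ X` under the structure map; this is how flatness comes
to bear on Frobenius transforms. -/
theorem mem_frobSpan_iff {X : Submodule R M} {y : M} :
    y ∈ frobSpan F X ↔ ∃ z : FrobTwist R p e ⊗[R] X, theta F (X.subtype.lTensor _ z) = y := by
  refine ⟨fun h => ?_, fun ⟨z, hz⟩ => hz ▸ theta_lTensor_subtype_mem X z⟩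
  induction h using Submodule.span_induction with
  | mem y h =>
    obtain ⟨x, hx, rfl⟩ := h
    refine ⟨1 ⊗ₜ ⟨x, hx⟩, ?_⟩
    rw [LinearMap.lTensor_tmul, theta_tmul, map_one, one_smul]
    rfl
  | zero => exact ⟨0, by rw [map_zero, map_zero]⟩
  | add x y _ _ hx hy =>
    obtain ⟨z, rfl⟩ := hx
    obtain ⟨w, rfl⟩ := hy
    exact ⟨z + w, by rw [map_add, map_add]⟩
  | smul a x _ hx =>
    obtain ⟨z, rfl⟩ := hx
    refine ⟨(FrobTwist.toRing R p e).symm a • z, ?_⟩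
    have : (X.subtype.lTensor (FrobTwist R p e)) ((FrobTwist.toRing R p e).symm a • z) =
        (FrobTwist.toRing R p e).symm a • (X.subtype.lTensor (FrobTwist R p e)) z :=
      (TensorProduct.AlgebraTensorModule.lTensor (FrobTwist R p e) (FrobTwist R p e)
        X.subtype).map_smul _ z
    rw [this, LinearMap.map_smulₛₗ]
    rfl

theorem frobSpan_top (hF : IsUnitModule F) : frobSpan F ⊤ = ⊤ := by
  rw [eq_top_iff]
  intro y _
  obtain ⟨t, rfl⟩ := hF.2 y
  induction t using TensorProduct.induction_on with
  | zero => rw [map_zero]; exact zero_mem _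
  | add x y hx hy => rw [map_add]; exact add_mem (hx trivial) (hy trivial)
  | tmul r x =>
    rw [theta_tmul]
    exact Submodule.smul_mem _ _ (apply_mem_frobSpan trivial)

theorem theta_restrict (N : Submodule R M) (h : ∀ x ∈ N, F x ∈ N) (z : Pullback R p e N) :
    (theta (restrict F N h) z : M) = theta F (N.subtype.lTensor _ z) := by
  induction z using TensorProduct.induction_on with
  | zero => rw [map_zero, map_zero, map_zero]; rfl
  | add x y hx hy => rw [map_add, map_add, map_add, Submodule.coe_add, hx, hy]
  | tmul r x => rfl

theorem IsUnitSubmodule.frobSpan_eq {N : Submodule R M} (hN : IsUnitSubmodule F N) :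
    frobSpan F N = N := by
  obtain ⟨h, hu⟩ := hN
  refine le_antisymm (frobSpan_le_iff.2 h) fun y hy => ?_
  obtain ⟨z, hz⟩ := hu.2 ⟨y, hy⟩
  rw [mem_frobSpan_iff]
  exact ⟨z, by rw [← theta_restrict N h, hz]⟩

/-- The equality gives surjectivity of the restricted structure map. Injectivity is inherited from
`M`, since flatness makes `R^e ⊗ N → R^e ⊗ M` injective. -/
theorem isUnitSubmodule_of_frobSpan_eq [Module.Flat R (FrobTwist R p e)] (hF : IsUnitModule F)
    {N : Submodule R M} (hN : frobSpan F N = N) : IsUnitSubmodule F N := by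
  have h : ∀ x ∈ N, F x ∈ N := frobSpan_le_iff.1 hN.le
  refine ⟨h, fun x y hxy => ?_, fun y => ?_⟩
  · apply Module.Flat.lTensor_preserves_injective_linearMap N.subtype N.injective_subtype
    apply hF.1
    rw [← theta_restrict N h, ← theta_restrict N h, hxy]
  · obtain ⟨z, hz⟩ := mem_frobSpan_iff.1 (hN.ge y.2)
    exact ⟨z, Subtype.ext ((theta_restrict N h z).trans hz)⟩

/-- Flatness of the Frobenius makes `frobSpan` compatible with intersections. -/
theorem inf_frobSpan_le [Module.Flat R (FrobTwist R p e)] (hF : IsUnitModule F)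
    {N : Submodule R M} (hN : N ≤ frobSpan F N) (X : Submodule R M) :
    N ⊓ frobSpan F X ≤ frobSpan F (N ⊓ X) := by
  rintro y ⟨hyN, hyX⟩
  obtain ⟨w, hw⟩ := mem_frobSpan_iff.1 (hN hyN)
  obtain ⟨z, rfl⟩ := mem_frobSpan_iff.1 hyX
  have heq := hF.1 hw
  -- The kernel of `f` is `N ∩ X`. By injectivity of the structure map, `z` agrees in `R^e ⊗ M` with
  -- an element from `R^e ⊗ N`, so `f` kills it, and flatness brings it from `R^e ⊗ (N ∩ X)`.
  let f : X →ₗ[R] M ⧸ N := N.mkQ.comp X.subtype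
  have hz : f.lTensor (FrobTwist R p e) z = 0 := by
    rw [LinearMap.lTensor_comp, LinearMap.comp_apply, ← heq, ← LinearMap.comp_apply,
      ← LinearMap.lTensor_comp]
    have : N.mkQ.comp N.subtype = 0 := by ext x; simp
    rw [this, LinearMap.lTensor_zero, LinearMap.zero_apply]
  have hex := Module.Flat.lTensor_exact (FrobTwist R p e)
    (f := (LinearMap.ker f).subtype) (g := f) (LinearMap.exact_subtype_ker_map f)
  obtain ⟨u, rfl⟩ := (hex z).1 hz
  clear hz hyX hyN hw heq
  induction u using TensorProduct.induction_on with
  | zero => simp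
  | add a b ha hb => rw [map_add, map_add, map_add]; exact add_mem ha hb
  | tmul r x =>
    refine Submodule.smul_mem _ _ (apply_mem_frobSpan ⟨?_, x.1.2⟩)
    have := x.2
    rwa [LinearMap.mem_ker, LinearMap.comp_apply, Submodule.mkQ_apply,
      Submodule.Quotient.mk_eq_zero] at this

theorem monotone_iterate_frobSpan {X : Submodule R M} (hX : X ≤ frobSpan F X) :
    Monotone fun n => (frobSpan F)^[n] X :=
  frobSpan_mono.monotone_iterate_of_le_map hX

/-- A finitely generated unit module has a root: a finitely generated submodule `X` contained in
`R F(X)`, whose Frobenius transforms exhaust `M`. -/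
theorem exists_root (hF : IsUnitModule F) (hfg : IsFG F) : ∃ X : Submodule R M, X.FG ∧
    X ≤ frobSpan F X ∧ ∀ x, ∃ n, x ∈ (frobSpan F)^[n] X := by
  classical
  obtain ⟨S, hS⟩ := hfg
  have hclosed : ∀ W : ℕ → Submodule R M, Monotone W → (S : Set M) ⊆ W 0 →
      (∀ n, ∀ x ∈ W n, F x ∈ W (n + 1)) → ∀ x, ∃ n, x ∈ W n := by
    intro W hW h0 hstep x
    have hmem : ∀ x, x ∈ ⨆ n, W n ↔ ∃ n, x ∈ W n := fun x =>
      Submodule.mem_iSup_of_directed W hW.directed_le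
    have htop := hS (⨆ n, W n) (fun s hs => (hmem s).2 ⟨0, h0 hs⟩) (fun x hx => by
      obtain ⟨n, hn⟩ := (hmem x).1 hx
      exact (hmem _).2 ⟨n + 1, hstep n x hn⟩)
    exact (hmem x).1 (htop ▸ trivial)
  let T : ℕ → Finset M := fun n => (Finset.range (n + 1)).biUnion fun i => S.image F^[i]
  have hT : ∀ n x, x ∈ T n ↔ ∃ i ≤ n, ∃ s ∈ S, F^[i] s = x := fun n x => by
    simp [T]
  let W : ℕ → Submodule R M := fun n => Submodule.span R (T n)
  have hWmono : Monotone W := fun m n h => Submodule.span_mono fun x hx => by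
    obtain ⟨i, hi, hx⟩ := (hT m x).1 hx
    exact (hT n x).2 ⟨i, hi.trans h, hx⟩
  have hWstep : ∀ n, ∀ x ∈ W n, F x ∈ W (n + 1) := by
    intro n x hx
    induction hx using Submodule.span_induction with
    | mem x hx =>
      obtain ⟨i, hi, s, hs, rfl⟩ := (hT n x).1 hx
      refine Submodule.subset_span ((hT _ _).2 ⟨i + 1, by omega, s, hs, ?_⟩)
      rw [Function.iterate_succ_apply']
    | zero => rw [map_zero]; exact zero_mem _
    | add x y _ _ hx hy => rw [map_add]; exact add_mem hx hy
    | smul a x _ hx => rw [LinearMap.map_smulₛₗ]; exact Submodule.smul_mem _ _ hx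
  have hW := hclosed W hWmono
    (fun s hs => Submodule.subset_span ((hT 0 s).2 ⟨0, le_rfl, s, hs, rfl⟩)) hWstep
  have hfrob : ∀ x, ∃ n, x ∈ frobSpan F (W n) := by
    intro x
    obtain ⟨t, rfl⟩ := hF.2 x
    induction t using TensorProduct.induction_on with
    | zero => exact ⟨0, by rw [map_zero]; exact zero_mem _⟩
    | add x y hx hy =>
      obtain ⟨m, hm⟩ := hx
      obtain ⟨n, hn⟩ := hy
      refine ⟨max m n, ?_⟩
      rw [map_add]
      exact add_mem (frobSpan_mono (hWmono (le_max_left m n)) hm)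
        (frobSpan_mono (hWmono (le_max_right m n)) hn)
    | tmul r x =>
      obtain ⟨n, hn⟩ := hW x
      exact ⟨n, by rw [theta_tmul]; exact Submodule.smul_mem _ _ (apply_mem_frobSpan hn)⟩
  choose ν hν using hfrob
  -- `N` is large enough for the generators themselves to lie in the span of `F (W N)`; the further
  -- elements `F^[i + 1] s` of `W N` lie there automatically.
  let N := S.sup ν
  have hroot : W N ≤ frobSpan F (W N) := by
    rw [Submodule.span_le]
    intro x hx
    obtain ⟨i, hi, s, hs, rfl⟩ := (hT N x).1 hx
    rcases i with _ | i
    · exact frobSpan_mono (hWmono (Finset.le_sup hs)) (hν s)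
    · rw [Function.iterate_succ_apply']
      exact apply_mem_frobSpan (Submodule.subset_span ((hT _ _).2 ⟨i, by omega, s, hs, rfl⟩))
  refine ⟨W N, ⟨T N, rfl⟩, hroot, ?_⟩
  refine hclosed _ (monotone_iterate_frobSpan hroot)
    (fun s hs => Submodule.subset_span ((hT N s).2 ⟨0, Nat.zero_le _, s, hs, rfl⟩)) ?_
  intro n x hx
  rw [Function.iterate_succ_apply']
  exact apply_mem_frobSpan hx

/-- Unit submodules of a finitely generated unit module have roots, when `R` is noetherian with
flat Frobenius. -/
theorem exists_root_of_isUnitSubmodule [IsNoetherianRing R] [Module.Flat R (FrobTwist R p e)]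
    (hF : IsUnitModule F) (hfg : IsFG F) {N : Submodule R M} (hN : IsUnitSubmodule F N) :
    ∃ X : Submodule R M, X.FG ∧ X ≤ frobSpan F X ∧
      ∀ x, x ∈ N ↔ ∃ n, x ∈ (frobSpan F)^[n] X := by
  obtain ⟨X, hX, hroot, hexh⟩ := exists_root hF hfg
  have hNe := hN.frobSpan_eq
  have : IsNoetherian R X := isNoetherian_of_fg_of_noetherian X hX
  have hle : ∀ n, N ⊓ (frobSpan F)^[n] X ≤ (frobSpan F)^[n] (N ⊓ X) := by
    intro n
    induction n with
    | zero => exact le_rfl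
    | succ n ih =>
      rw [Function.iterate_succ_apply', Function.iterate_succ_apply']
      exact (inf_frobSpan_le hF hNe.ge _).trans (frobSpan_mono ih)
  have hge : ∀ n, (frobSpan F)^[n] (N ⊓ X) ≤ N := by
    intro n
    induction n with
    | zero => exact inf_le_left
    | succ n ih =>
      rw [Function.iterate_succ_apply']
      exact (frobSpan_mono ih).trans hNe.le
  refine ⟨N ⊓ X, hX.of_le inf_le_right, ?_, fun x => ⟨fun hx => ?_, ?_⟩⟩
  · exact (inf_le_inf_left N hroot).trans (inf_frobSpan_le hF hNe.ge X)
  · obtain ⟨n, hn⟩ := hexh x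
    exact ⟨n, hle n ⟨hx, hn⟩⟩
  · rintro ⟨n, hn⟩
    exact hge n hn

end Root

/-! ### Contraction of submodules along `m ↦ 1 ⊗ m`. -/

section

variable {k K R M : Type*} [Field k] [Field K] [Algebra k K] [CommRing R] [Algebra k R]
  [AddCommGroup M] [Module k M] [Module R M] [IsScalarTower k R M] {p e : ℕ} [ExpChar R p]

/-- The elements `m` with `1 ⊗ m` in `N`. -/
def contraction (N : Submodule (K ⊗[k] R) (K ⊗[k] M)) : Submodule R M where
  carrier := {m | (1 : K) ⊗ₜ[k] m ∈ N}
  add_mem' {x y} hx hy := by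
    rw [Set.mem_ofPred_eq, TensorProduct.tmul_add]
    exact add_mem hx hy
  zero_mem' := by
    rw [Set.mem_ofPred_eq, TensorProduct.tmul_zero]
    exact zero_mem _
  smul_mem' r x hx := by
    have := N.smul_mem ((1 : K) ⊗ₜ[k] r) hx
    rwa [tmul_smul_tmul, one_mul] at this

theorem mem_contraction {N : Submodule (K ⊗[k] R) (K ⊗[k] M)} {m : M} :
    m ∈ contraction N ↔ (1 : K) ⊗ₜ[k] m ∈ N := Iff.rfl

theorem tmul_mem_of_one_tmul_mem {N : Submodule (K ⊗[k] R) (K ⊗[k] M)} (a : K) {m : M}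
    (h : (1 : K) ⊗ₜ[k] m ∈ N) : a ⊗ₜ[k] m ∈ N := by
  have := N.smul_mem (a ⊗ₜ[k] (1 : R)) h
  rwa [tmul_smul_tmul, mul_one, one_smul] at this

theorem eq_top_of_contraction_eq_top {N : Submodule (K ⊗[k] R) (K ⊗[k] M)}
    (h : contraction N = ⊤) : N = ⊤ := by
  rw [eq_top_iff]
  intro x _
  induction x using TensorProduct.induction_on with
  | zero => exact zero_mem _
  | add x y hx hy => exact add_mem (hx trivial) (hy trivial)
  | tmul a m => exact tmul_mem_of_one_tmul_mem a (mem_contraction.1 (h ▸ trivial))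

theorem isFG_baseChange {F : M →ₛₗ[iterateFrobenius R p e] M} (hF : IsFG F) :
    IsFG (baseChange (k := k) K F) := by
  classical
  obtain ⟨S, hS⟩ := hF
  refine ⟨S.image fun m => (1 : K) ⊗ₜ[k] m, fun N hN hst => ?_⟩
  apply eq_top_of_contraction_eq_top
  refine hS _ (fun s hs => hN (by simpa using ⟨s, hs, rfl⟩)) (fun x hx => ?_)
  have := hst _ hx
  rwa [baseChange_tmul, one_pow] at this

end

/-! ### Infinitely `p`-divisible elements of finitely generated fields. -/

section PerfectClosure

open IntermediateField
open scoped IntermediateField.algebraAdjoinAdjoin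

/-- Writing `z = f(y) / g(y)` would give `f ^ p = X g ^ p` as polynomials, contradicting degrees
modulo `p`. -/
theorem mem_adjoin_root_of_pow_eq_false {L E : Type*} [Field L] [Field E] [Algebra L E] {y z : E}
    {p : ℕ} (hp : 1 < p) (hy : Transcendental L y) (hz : z ^ p = y) : z ∉ L⟮y⟯ := by
  intro hmem
  obtain ⟨f, g, rfl⟩ := (mem_adjoin_simple_iff L z).1 hmem
  have hg : Polynomial.aeval y g ≠ 0 := by
    intro h
    rw [h, div_zero, zero_pow (by omega)] at hz
    exact hy (hz ▸ isAlgebraic_zero)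
  rw [div_pow, div_eq_iff (pow_ne_zero _ hg)] at hz
  have h1 : f ^ p = Polynomial.X * g ^ p := by
    apply transcendental_iff_injective.1 hy
    simpa using hz
  have hg0 : g ≠ 0 := fun h => hg (by rw [h, map_zero])
  have h2 := congrArg Polynomial.natDegree h1
  rw [Polynomial.natDegree_pow, Polynomial.natDegree_X_mul (pow_ne_zero _ hg0),
    Polynomial.natDegree_pow] at h2
  have h3 : p ∣ p * g.natDegree + 1 := ⟨_, h2.symm⟩
  rw [Nat.dvd_add_right (dvd_mul_right _ _), Nat.dvd_one] at h3
  omega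

/-- The roots would generate a strictly increasing chain of fields `L(y_n)` between `L(x)` and `E`,
impossible in finite dimension. Injectivity of Frobenius makes arbitrarily chosen roots compatible.
-/
theorem not_forall_exists_pow_of_finite {L E : Type*} [Field L] [Field E] [Algebra L E] {x : E}
    {p : ℕ} [Fact p.Prime] [CharP E p] (hx : Transcendental L x) [FiniteDimensional L⟮x⟯ E] :
    ¬ ∀ n : ℕ, ∃ y : E, y ^ p ^ n = x := by
  intro h
  choose y hy using h
  have hp : 1 < p := (Fact.out : p.Prime).one_lt
  have hstep : ∀ n, y (n + 1) ^ p = y n := fun n => by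
    apply iterateFrobenius_inj E p n
    rw [iterateFrobenius_def, iterateFrobenius_def, ← pow_mul, ← pow_succ', hy, hy]
  have htr : ∀ n, Transcendental L (y n) := fun n (h : IsAlgebraic L (y n)) => hx (by rw [← hy n]; exact h.pow _)
  have hmono : Monotone fun n => L⟮y n⟯ := monotone_nat_of_le_succ fun n => by
    rw [adjoin_simple_le_iff, ← hstep n]
    exact pow_mem (mem_adjoin_simple_self L (y (n + 1))) p
  have hx' : ∀ n, L⟮x⟯ ≤ L⟮y n⟯ := fun n => by
    rw [adjoin_simple_le_iff, ← hy n]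
    exact pow_mem (mem_adjoin_simple_self L (y n)) _
  let C : ℕ →o Submodule L⟮x⟯ E :=
    ⟨fun n => Subalgebra.toSubmodule (extendScalars (hx' n)).toSubalgebra,
      fun m n hmn => hmono hmn⟩
  obtain ⟨n, hn⟩ := monotone_stabilizes_iff_noetherian.2 (inferInstance : IsNoetherian L⟮x⟯ E) C
  have h1 : y (n + 1) ∈ C (n + 1) := mem_adjoin_simple_self L (y (n + 1))
  rw [← hn (n + 1) (Nat.le_succ n)] at h1
  exact mem_adjoin_root_of_pow_eq_false hp (htr n) (hstep n) h1

/-- In a finitely generated extension of an algebraically closed field `k` of characteristic `p`,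
only the elements of `k` have `p ^ n`-th roots for all `n`. -/
theorem mem_range_algebraMap_of_forall_exists_pow {k E : Type*} [Field k] [IsAlgClosed k] [Field E]
    [Algebra k E] [Algebra.EssFiniteType k E] {p : ℕ} [Fact p.Prime] [CharP E p] {x : E}
    (h : ∀ n : ℕ, ∃ y : E, y ^ p ^ n = x) : x ∈ (algebraMap k E).range := by
  by_contra hx
  have htr : Transcendental k x := fun halg => hx
    (minpoly.mem_range_of_degree_eq_one k x
      (IsAlgClosed.degree_eq_one_of_irreducible k (minpoly.irreducible halg.isIntegral)))
  have hind : AlgebraicIndepOn k id ({x} : Set E) :=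
    (algebraicIndependent_singleton_iff (⟨x, rfl⟩ : ({x} : Set E))).2 htr
  -- With `x` in a transcendence basis and `L` generated by its other members, `x` is transcendental
  -- over `L` and `E` is finite over `L(x)`.
  obtain ⟨t, hxt, ht⟩ := exists_isTranscendenceBasis_superset hind
  have hxt : x ∈ t := hxt rfl
  let L := adjoin k (t \ {x})
  have hL : Transcendental L x := by
    have h1 := ht.1.transcendental_adjoin (s := {⟨x, hxt⟩}ᶜ) (i := ⟨x, hxt⟩) (by simp)
    have h2 : ((↑) : t → E) '' {⟨x, hxt⟩}ᶜ = t \ {x} := by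
      ext z
      simp
    rw [h2] at h1
    intro h3
    exact h1 ((IsFractionRing.isAlgebraic_iff (Algebra.adjoin k (t \ {x})) L E).2 h3)
  have halg : Algebra.IsAlgebraic L⟮x⟯ E := by
    have h1 := ht.isAlgebraic_field
    rw [Subtype.range_coe] at h1
    have hle : adjoin k t ≤ (restrictScalars k L⟮x⟯) := by
      rw [adjoin_le_iff]
      intro z hz
      by_cases hzx : z = x
      · subst hzx
        exact mem_adjoin_simple_self L z
      · exact (IntermediateField.algebraMap_mem L⟮x⟯ (⟨z, subset_adjoin k _ ⟨hz, hzx⟩⟩ : L))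
    constructor
    intro z
    exact (h1.isAlgebraic z).tower_top_of_subalgebra_le
      (A := (adjoin k t).toSubalgebra) (B := (restrictScalars k L⟮x⟯).toSubalgebra) hle
  have : IsScalarTower k L⟮x⟯ E := IsScalarTower.of_algebraMap_eq fun _ => rfl
  have : Algebra.EssFiniteType L⟮x⟯ E := Algebra.EssFiniteType.of_comp k L⟮x⟯ E
  have : FiniteDimensional L⟮x⟯ E := Algebra.finite_of_essFiniteType_of_isAlgebraic
  exact not_forall_exists_pow_of_finite hL h

end PerfectClosure

/-! ### Fields of definition of subspaces of `K ⊗ V`. -/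

section Descent

variable {k K V : Type*} [Field k] [Field K] [Algebra k K] [AddCommGroup V] [Module k V]

variable (V) in
/-- The image of `L ⊗ V` in `K ⊗ V`, for an intermediate field `L`. -/
def rationalPart (L : IntermediateField k K) : AddSubgroup (K ⊗[k] V) :=
  AddSubgroup.closure {x | ∃ a ∈ L, ∃ v : V, a ⊗ₜ[k] v = x}

theorem tmul_mem_rationalPart {L : IntermediateField k K} {a : K} (ha : a ∈ L) (v : V) :
    a ⊗ₜ[k] v ∈ rationalPart V L := AddSubgroup.subset_closure ⟨a, ha, v, rfl⟩

theorem rationalPart_mono {L L' : IntermediateField k K} (h : L ≤ L') :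
    rationalPart V L ≤ rationalPart V L' :=
  AddSubgroup.closure_mono fun _ ⟨a, ha, v, hv⟩ => ⟨a, h ha, v, hv⟩

theorem exists_mem_rationalPart (G : Finset (K ⊗[k] V)) : ∃ S : Finset K,
    ∀ g ∈ G, g ∈ rationalPart V (IntermediateField.adjoin k (S : Set K)) := by
  classical
  have h1 : ∀ g : K ⊗[k] V, ∃ S : Finset K,
      g ∈ rationalPart V (IntermediateField.adjoin k (S : Set K)) := by
    intro g
    induction g using TensorProduct.induction_on with
    | zero => exact ⟨∅, zero_mem _⟩
    | add x y hx hy =>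
      obtain ⟨S, hS⟩ := hx
      obtain ⟨S', hS'⟩ := hy
      refine ⟨S ∪ S', add_mem (rationalPart_mono ?_ hS) (rationalPart_mono ?_ hS')⟩
      · exact IntermediateField.adjoin.mono _ _ _ (by simp)
      · exact IntermediateField.adjoin.mono _ _ _ (by simp)
    | tmul a v =>
      exact ⟨{a}, tmul_mem_rationalPart (IntermediateField.subset_adjoin _ _ (by simp)) v⟩
  choose S hS using h1
  refine ⟨G.biUnion S, fun g hg => rationalPart_mono ?_ (hS g)⟩
  exact IntermediateField.adjoin.mono _ _ _ (Finset.coe_subset.2 (Finset.subset_biUnion_of_mem S hg))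

/-- A `K`-subspace of `K ⊗ V` which is spanned by its `L`-rational elements is preserved by
`π ⊗ 1` for every `L`-linear `π : K → L`. -/
theorem rTensor_mem_of_le_span {L : IntermediateField k K} {W : Submodule K (K ⊗[k] V)}
    (hW : W ≤ Submodule.span K {w | w ∈ W ∧ w ∈ rationalPart V L}) (π : K →ₗ[L] L) {w : K ⊗[k] V}
    (hw : w ∈ W) : (L.val.toLinearMap ∘ₗ π.restrictScalars k).rTensor V w ∈ W := by
  -- On a multiple `c w` of a rational `w`, the map only replaces `c` by `π c`.
  have key : ∀ w ∈ rationalPart V L, ∀ c : K,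
      (L.val.toLinearMap ∘ₗ π.restrictScalars k).rTensor V (c • w) = (π c : K) • w := by
    intro w hw c
    induction hw using AddSubgroup.closure_induction with
    | mem x hx =>
      obtain ⟨a, ha, v, rfl⟩ := hx
      rw [TensorProduct.smul_tmul', LinearMap.rTensor_tmul, TensorProduct.smul_tmul']
      congr 1
      have : c • a = (⟨a, ha⟩ : L) • c := mul_comm c a
      rw [this, LinearMap.comp_apply, LinearMap.restrictScalars_apply, LinearMap.map_smul]
      exact mul_comm _ _
    | zero => simp
    | add x y _ _ hx hy => rw [smul_add, map_add, hx, hy, smul_add]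
    | neg x _ hx => rw [smul_neg, map_neg, hx, smul_neg]
  have hspan := hW hw
  clear hw
  induction hspan using Submodule.closure_induction with
  | zero => rw [map_zero]; exact zero_mem _
  | add x y _ _ hx hy => rw [map_add]; exact add_mem hx hy
  | smul_mem c x hx => rw [key x hx.2]; exact W.smul_mem _ hx.1

/-- Descent of a subspace from `K` to `k`, along fields of definition with intersection `k`. -/
theorem le_span_one_tmul {L : ℕ → IntermediateField k K} {W : Submodule K (K ⊗[k] V)}
    (hL : ∀ a, (∀ n, a ∈ L n) → a ∈ (algebraMap k K).range)
    (hW : ∀ n, W ≤ Submodule.span K {w | w ∈ W ∧ w ∈ rationalPart V (L n)}) :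
    W ≤ Submodule.span K {w | w ∈ W ∧ ∃ v : V, (1 : K) ⊗ₜ[k] v = w} := by
  have hπ : ∀ n, ∃ π : K →ₗ[L n] L n, π 1 = 1 := by
    intro n
    obtain ⟨π, hπ⟩ := (Algebra.linearMap (L n) K).exists_leftInverse_of_injective
      (LinearMap.ker_eq_bot.2 (algebraMap (L n) K).injective)
    exact ⟨π, by simpa using LinearMap.congr_fun hπ 1⟩
  choose π hπ using hπ
  -- A basis of the quotient by `W` is chosen among classes of elements `1 ⊗ v`; the aim is to show
  -- that the coordinates of every such class lie in `k`.
  let q : V → (K ⊗[k] V) ⧸ W := fun v => W.mkQ ((1 : K) ⊗ₜ[k] v)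
  obtain ⟨κ, u, -, hspan, hli⟩ := exists_linearIndependent' K q
  have hq : ∀ v, q v ∈ Submodule.span K (Set.range (q ∘ u)) := fun v =>
    hspan ▸ Submodule.subset_span ⟨v, rfl⟩
  let P : (κ →₀ K) →ₗ[K] K ⊗[k] V :=
    Finsupp.linearCombination K (fun i => (1 : K) ⊗ₜ[k] u i)
  have hPinj : ∀ c, P c ∈ W → c = 0 := by
    intro c hc
    apply (linearIndependent_iff.1 hli) c
    have h1 : W.mkQ (P c) = 0 := by simpa using hc
    rw [← h1, Finsupp.apply_linearCombination]
    rfl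
  have hex : ∀ v, ∃ c, (1 : K) ⊗ₜ[k] v - P c ∈ W := by
    intro v
    obtain ⟨c, hc⟩ := Finsupp.mem_span_range_iff_exists_finsupp.1 (hq v)
    refine ⟨c, ?_⟩
    rw [← Submodule.Quotient.mk_eq_zero, Submodule.Quotient.mk_sub, sub_eq_zero]
    change q v = W.mkQ (P c)
    rw [← hc, Finsupp.apply_linearCombination]
    rfl
  choose c hc using hex
  -- The retraction `π n` preserves `W` and fixes `1 ⊗ v`, so it carries the coordinates of `v` to
  -- coordinates of `v`. By uniqueness they are fixed, hence in `L n`.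
  have hcL : ∀ v i n, c v i ∈ L n := by
    intro v i n
    let T := ((L n).val.toLinearMap ∘ₗ (π n).restrictScalars k).rTensor V
    let π' : K →+ K := ((L n).val.toLinearMap ∘ₗ (π n).restrictScalars k).toAddMonoidHom
    have hTP : ∀ d : κ →₀ K, T (P d) = P (d.mapRange π' (map_zero π')) := by
      intro d
      induction d using Finsupp.induction_linear with
      | zero => simp
      | add f g hf hg => rw [map_add, map_add, hf, hg, Finsupp.mapRange_add (map_add π'), map_add]
      | single i a =>
        rw [Finsupp.mapRange_single, Finsupp.linearCombination_single,
          Finsupp.linearCombination_single, TensorProduct.smul_tmul', TensorProduct.smul_tmul',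
          LinearMap.rTensor_tmul, smul_eq_mul, smul_eq_mul, mul_one, mul_one]
        rfl
    have h1 : T ((1 : K) ⊗ₜ[k] v - P (c v)) ∈ W := rTensor_mem_of_le_span (hW n) (π n) (hc v)
    have h2 : T ((1 : K) ⊗ₜ[k] v) = (1 : K) ⊗ₜ[k] v := by
      rw [LinearMap.rTensor_tmul, LinearMap.comp_apply, LinearMap.restrictScalars_apply, hπ]
      rfl
    rw [map_sub, h2, hTP] at h1
    have h3 := sub_mem h1 (hc v)
    rw [sub_sub_sub_cancel_left, ← map_sub] at h3
    have h4 := DFunLike.congr_fun (hPinj _ h3) i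
    rw [Finsupp.sub_apply, Finsupp.mapRange_apply, Finsupp.zero_apply, sub_eq_zero] at h4
    rw [h4]
    exact (π n (c v i)).2
  set D := {w | w ∈ W ∧ ∃ v : V, (1 : K) ⊗ₜ[k] v = w}
  have hD : ∀ v, (1 : K) ⊗ₜ[k] v - P (c v) ∈ D := by
    intro v
    refine ⟨hc v, ?_⟩
    choose c' hc' using fun i => hL (c v i) (hcL v i)
    refine ⟨v - ∑ i ∈ (c v).support, c' i • u i, ?_⟩
    have hP : P (c v) = ∑ i ∈ (c v).support, c v i • ((1 : K) ⊗ₜ[k] u i) :=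
      Finsupp.linearCombination_apply _ _
    rw [TensorProduct.tmul_sub, TensorProduct.tmul_sum, hP]
    congr 1
    refine Finset.sum_congr rfl fun i _ => ?_
    rw [TensorProduct.tmul_smul, ← hc' i, algebraMap_smul]
  have hdec : ∀ x : K ⊗[k] V, ∃ d, x - P d ∈ Submodule.span K D := by
    intro x
    induction x using TensorProduct.induction_on with
    | zero => exact ⟨0, by simp⟩
    | add x y hx hy =>
      obtain ⟨d, hd⟩ := hx
      obtain ⟨d', hd'⟩ := hy
      refine ⟨d + d', ?_⟩
      rw [map_add, add_sub_add_comm]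
      exact add_mem hd hd'
    | tmul a v =>
      refine ⟨a • c v, ?_⟩
      have : a ⊗ₜ[k] v - P (a • c v) = a • ((1 : K) ⊗ₜ[k] v - P (c v)) := by
        rw [smul_sub, map_smul, TensorProduct.smul_tmul', smul_eq_mul, mul_one]
      rw [this]
      exact Submodule.smul_mem _ _ (Submodule.subset_span (hD v))
  intro w hw
  obtain ⟨d, hd⟩ := hdec w
  have hDW : Submodule.span K D ≤ W := Submodule.span_le.2 fun x hx => hx.1
  have hd0 : d = 0 := hPinj d (by
    have := sub_mem hw (hDW hd)
    rwa [sub_sub_cancel] at this)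
  rwa [hd0, map_zero, sub_zero] at hd

end Descent

/-! ### Descent of unit submodules, and simplicity over `K`. -/

section UnitDescent

variable {k K R M : Type*} [Field k] [Field K] [Algebra k K] [CommRing R] [Algebra k R]
  [AddCommGroup M] [Module k M] [Module R M] [IsScalarTower k R M] {p e : ℕ} [ExpChar R p]
  {F : M →ₛₗ[iterateFrobenius R p e] M}

theorem tmul_one_smul (a : K) (x : K ⊗[k] M) : (a ⊗ₜ[k] (1 : R)) • x = a • x := by
  induction x using TensorProduct.induction_on with
  | zero => rw [smul_zero, smul_zero]
  | add x y hx hy => rw [smul_add, smul_add, hx, hy]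
  | tmul b m => rw [tmul_smul_tmul, one_smul, TensorProduct.smul_tmul', smul_eq_mul]

/-- A submodule over `K ⊗ R` as a `K`-subspace. -/
def toSubspace (N : Submodule (K ⊗[k] R) (K ⊗[k] M)) : Submodule K (K ⊗[k] M) where
  __ := N.toAddSubmonoid
  smul_mem' a x hx := by
    rw [← tmul_one_smul (R := R) a x]
    exact N.smul_mem _ hx

theorem one_tmul_smul_mem_rationalPart {L : IntermediateField k K} (r : R) {x : K ⊗[k] M}
    (hx : x ∈ rationalPart M L) : ((1 : K) ⊗ₜ[k] r) • x ∈ rationalPart M L := by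
  induction hx using AddSubgroup.closure_induction with
  | mem x hx =>
    obtain ⟨a, ha, m, rfl⟩ := hx
    rw [tmul_smul_tmul, one_mul]
    exact tmul_mem_rationalPart ha _
  | zero => rw [smul_zero]; exact zero_mem _
  | add x y _ _ hx hy => rw [smul_add]; exact add_mem hx hy
  | neg x _ hx => rw [smul_neg]; exact neg_mem hx

/-- A submodule generated by `L`-rational elements is spanned over `K` by `L`-rational elements. -/
theorem toSubspace_span_le {L : IntermediateField k K} {G : Set (K ⊗[k] M)}
    (hG : ∀ g ∈ G, g ∈ rationalPart M L) :
    toSubspace (Submodule.span (K ⊗[k] R) G) ≤ Submodule.span K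
      {w | w ∈ toSubspace (Submodule.span (K ⊗[k] R) G) ∧ w ∈ rationalPart M L} := by
  intro y hy
  have hy' : y ∈ Submodule.span (K ⊗[k] R) G := hy
  clear hy
  induction hy' using Submodule.closure_induction with
  | zero => exact zero_mem _
  | add x y _ _ hx hy => exact add_mem hx hy
  | smul_mem c g hg =>
    clear * - hG hg
    induction c using TensorProduct.induction_on with
    | zero => rw [zero_smul]; exact zero_mem _
    | add c d hc hd => rw [add_smul]; exact add_mem hc hd
    | tmul a r =>
      have : (a ⊗ₜ[k] r) • g = a • (((1 : K) ⊗ₜ[k] r) • g) := by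
        rw [← tmul_one_smul (R := R), smul_smul, Algebra.TensorProduct.tmul_mul_tmul, mul_one,
          one_mul]
      rw [this]
      exact Submodule.smul_mem _ _ (Submodule.subset_span
        ⟨Submodule.smul_mem _ _ (Submodule.subset_span hg),
          one_tmul_smul_mem_rationalPart r (hG g hg)⟩)

theorem baseChange_mem_rationalPart {L L' : IntermediateField k K}
    (h : ∀ a ∈ L, a ^ p ^ e ∈ L') {x : K ⊗[k] M} (hx : x ∈ rationalPart M L) :
    baseChange K F x ∈ rationalPart M L' := by
  induction hx using AddSubgroup.closure_induction with
  | mem x hx =>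
    obtain ⟨a, ha, m, rfl⟩ := hx
    rw [baseChange_tmul]
    exact tmul_mem_rationalPart (h a ha) _
  | zero => rw [map_zero]; exact zero_mem _
  | add x y _ _ hx hy => rw [map_add]; exact add_mem hx hy
  | neg x _ hx => rw [map_neg]; exact neg_mem hx

theorem frobSpan_span {R M : Type*} [CommRing R] {p e : ℕ} [ExpChar R p] [AddCommGroup M]
    [Module R M] (F : M →ₛₗ[iterateFrobenius R p e] M) (G : Set M) :
    frobSpan F (Submodule.span R G) = Submodule.span R (F '' G) := by
  apply le_antisymm
  · rw [frobSpan_le_iff]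
    intro x hx
    induction hx using Submodule.span_induction with
    | mem x hx => exact Submodule.subset_span ⟨x, hx, rfl⟩
    | zero => rw [map_zero]; exact zero_mem _
    | add x y _ _ hx hy => rw [map_add]; exact add_mem hx hy
    | smul a x _ hx => rw [LinearMap.map_smulₛₗ]; exact Submodule.smul_mem _ _ hx
  · exact Submodule.span_mono (Set.image_mono Submodule.subset_span)

theorem iterate_frobSpan_span {R M : Type*} [CommRing R] {p e : ℕ} [ExpChar R p] [AddCommGroup M]
    [Module R M] (F : M →ₛₗ[iterateFrobenius R p e] M) (G : Set M) (n : ℕ) :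
    (frobSpan F)^[n] (Submodule.span R G) = Submodule.span R (F^[n] '' G) := by
  induction n with
  | zero => simp
  | succ n ih =>
    rw [Function.iterate_succ_apply', ih, frobSpan_span, ← Set.image_comp,
      ← Function.iterate_succ']

/-- The subfield `L ^ (p ^ e)` of `K`, for `k` perfect. -/
def frobField [IsAlgClosed k] [ExpChar K p] [Fact p.Prime] (L : IntermediateField k K) (e : ℕ) :
    IntermediateField k K :=
  (L.toSubfield.map (iterateFrobenius K p e)).toIntermediateField fun c => by
    obtain ⟨d, rfl⟩ := IsAlgClosed.exists_pow_nat_eq c (pow_pos (Fact.out : p.Prime).pos e)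
    exact ⟨algebraMap k K d, L.algebraMap_mem d, by
      rw [iterateFrobenius_def, map_pow]⟩

theorem mem_frobField [IsAlgClosed k] [ExpChar K p] [Fact p.Prime] {L : IntermediateField k K}
    {e : ℕ} {a : K} : a ∈ frobField (p := p) L e ↔ ∃ b ∈ L, b ^ p ^ e = a := Iff.rfl

theorem mem_range_algebraMap_of_forall_mem_frobField [IsAlgClosed k] [CharP K p] [ExpChar K p]
    [Fact p.Prime] {S : Finset K} {e : ℕ} (he : 0 < e) {a : K}
    (ha : ∀ n, a ∈ frobField (p := p) (IntermediateField.adjoin k (S : Set K)) (e * n)) :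
    a ∈ (algebraMap k K).range := by
  set E := IntermediateField.adjoin k (S : Set K)
  have hE : Algebra.EssFiniteType k E :=
    IntermediateField.essFiniteType_iff.2 (IntermediateField.fg_adjoin_finset S)
  obtain ⟨b, hb, hba⟩ := mem_frobField.1 (ha 0)
  rw [mul_zero, pow_zero, pow_one] at hba
  subst hba
  obtain ⟨c, hc⟩ := mem_range_algebraMap_of_forall_exists_pow (k := k) (E := E) (p := p)
    (x := ⟨b, hb⟩) (fun n => by
      obtain ⟨d, hd, hdb⟩ := mem_frobField.1 (ha n)
      -- A `p ^ n`-th root is wanted and a `p ^ (e n)`-th root is given; `e > 0` ensures `n ≤ e n`.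
      refine ⟨⟨d ^ p ^ (e * n - n), pow_mem hd _⟩, Subtype.ext ?_⟩
      change (d ^ p ^ (e * n - n)) ^ p ^ n = b
      rw [← pow_mul, ← pow_add, Nat.sub_add_cancel (Nat.le_mul_of_pos_left n he), hdb])
  exact ⟨c, congrArg Subtype.val hc⟩

/-- Every unit submodule of `K ⊗ M` is defined over `k`. -/
theorem toSubspace_le_span_one_tmul [IsAlgClosed k] [IsAlgClosed K] [Fact p.Prime]
    [IsNoetherianRing (K ⊗[k] R)]
    [Module.Flat (K ⊗[k] R) (FrobTwist (K ⊗[k] R) p e)] (he : 0 < e) (hF : IsUnitModule F)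
    (hfg : IsFG F) {N : Submodule (K ⊗[k] R) (K ⊗[k] M)}
    (hN : IsUnitSubmodule (baseChange K F) N) :
    toSubspace N ≤ Submodule.span K {w | w ∈ toSubspace N ∧ ∃ m : M, (1 : K) ⊗ₜ[k] m = w} := by
  have hexp : ExpChar K p := expChar_ext k K R p
  have hchar : CharP K p := by
    cases hexp with
    | zero => exact absurd (Fact.out : Nat.Prime 1) Nat.not_prime_one
    | prime => assumption
  obtain ⟨X, ⟨G, rfl⟩, hroot, hexh⟩ :=
    exists_root_of_isUnitSubmodule (isUnitModule_baseChange hF) (isFG_baseChange hfg) hN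
  obtain ⟨S, hS⟩ := exists_mem_rationalPart G
  set E := IntermediateField.adjoin k (S : Set K)
  let L : ℕ → IntermediateField k K := fun n => frobField (p := p) E (e * n)
  have hLanti : ∀ m n, m ≤ n → L n ≤ L m := by
    intro m n hmn a ha
    obtain ⟨b, hb, rfl⟩ := mem_frobField.1 ha
    refine mem_frobField.2 ⟨b ^ p ^ (e * (n - m)), pow_mem hb _, ?_⟩
    rw [← pow_mul, ← pow_add, ← mul_add, Nat.sub_add_cancel hmn]
  have hstep : ∀ n, ∀ a ∈ L n, a ^ p ^ e ∈ L (n + 1) := by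
    intro n a ha
    obtain ⟨b, hb, rfl⟩ := mem_frobField.1 ha
    exact mem_frobField.2 ⟨b, hb, by rw [mul_add, pow_add, pow_mul, mul_one]⟩
  have hG : ∀ n, ∀ g ∈ (baseChange K F)^[n] '' (G : Set (K ⊗[k] M)), g ∈ rationalPart M (L n) := by
    intro n
    induction n with
    | zero =>
      rintro _ ⟨g, hg, rfl⟩
      refine rationalPart_mono ?_ (hS g hg)
      intro a ha
      exact mem_frobField.2 ⟨a, ha, by rw [mul_zero, pow_zero, pow_one]⟩
    | succ n ih =>
      rintro _ ⟨g, hg, rfl⟩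
      rw [Function.iterate_succ_apply']
      exact baseChange_mem_rationalPart (hstep n) (ih _ ⟨g, hg, rfl⟩)
  refine le_span_one_tmul (L := L)
    (fun a ha => mem_range_algebraMap_of_forall_mem_frobField he ha) (fun n y hy => ?_)
  obtain ⟨m, hm⟩ := (hexh y).1 hy
  -- The element may appear at a stage before `n`; moving to stage `max m n` makes the generators
  -- rational over `L n`, as the fields decrease.
  have hm' := monotone_iterate_frobSpan hroot (le_max_left m n) hm
  beta_reduce at hm'
  rw [iterate_frobSpan_span] at hm'
  refine Submodule.span_mono ?_ (toSubspace_span_le (hG (max m n)) hm')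
  rintro w ⟨hw, hwL⟩
  refine ⟨(hexh w).2 ⟨max m n, ?_⟩, rationalPart_mono (hLanti _ _ (le_max_right m n)) hwL⟩
  rw [iterate_frobSpan_span]
  exact hw

/-- If `1 ⊗ m` lies in the `K`-span of `1 ⊗ P`, then `m` lies in `P`. -/
theorem mem_of_one_tmul_mem_span {V : Type*} [AddCommGroup V] [Module k V] {P : Submodule k V}
    {m : V} (h : (1 : K) ⊗ₜ[k] m ∈ Submodule.span K ((fun v => (1 : K) ⊗ₜ[k] v) '' (P : Set V))) :
    m ∈ P := by
  have h0 : P.mkQ.baseChange K ((1 : K) ⊗ₜ[k] m) = 0 := by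
    have hle : Submodule.span K ((fun v => (1 : K) ⊗ₜ[k] v) '' (P : Set V)) ≤
        LinearMap.ker (P.mkQ.baseChange K) := by
      rw [Submodule.span_le]
      rintro _ ⟨v, hv, rfl⟩
      rw [SetLike.mem_coe, LinearMap.mem_ker, LinearMap.baseChange_tmul, Submodule.mkQ_apply,
        (Submodule.Quotient.mk_eq_zero P).2 hv, TensorProduct.tmul_zero]
    exact hle h
  rw [LinearMap.baseChange_tmul] at h0
  have hinj : Function.Injective fun q : V ⧸ P => (1 : K) ⊗ₜ[k] q :=
    Module.FaithfullyFlat.tensorProduct_mk_injective (A := k) (B := K) (V ⧸ P)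
  rw [← Submodule.Quotient.mk_eq_zero]
  exact hinj (h0.trans (TensorProduct.tmul_zero _ _).symm)

/-- As `N` is spanned by its elements `1 ⊗ m`, its Frobenius image lies in the `K`-span of `1 ⊗ P`,
where `P` is the transform of the contraction. This span is stable under `K ⊗ R`, so it contains
`N`, and faithful flatness of `K` over `k` brings the inclusion back to `M`. -/
theorem frobSpan_contraction_eq {N : Submodule (K ⊗[k] R) (K ⊗[k] M)}
    (hN : IsUnitSubmodule (baseChange K F) N)
    (hdesc : toSubspace N ≤
      Submodule.span K {w | w ∈ toSubspace N ∧ ∃ m : M, (1 : K) ⊗ₜ[k] m = w}) :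
    frobSpan F (contraction N) = contraction N := by
  have hNe := hN.frobSpan_eq
  have hstable : ∀ x ∈ N, baseChange K F x ∈ N := frobSpan_le_iff.1 hNe.le
  apply le_antisymm
  · rw [frobSpan_le_iff]
    intro m hm
    have := hstable _ hm
    rwa [baseChange_tmul, one_pow] at this
  · let P : Submodule k M := (frobSpan F (contraction N)).restrictScalars k
    have hPK : ∀ x ∈ N, baseChange K F x ∈
        Submodule.span K ((fun v => (1 : K) ⊗ₜ[k] v) '' (P : Set M)) := by
      intro x hx
      have hx' := hdesc hx
      clear hx
      induction hx' using Submodule.closure_induction with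
      | zero => rw [map_zero]; exact zero_mem _
      | add x y _ _ hx hy => rw [map_add]; exact add_mem hx hy
      | smul_mem c w hw =>
        obtain ⟨hwN, m, rfl⟩ := hw
        rw [TensorProduct.smul_tmul', smul_eq_mul, mul_one, baseChange_tmul]
        have : (c ^ p ^ e) ⊗ₜ[k] F m = (c ^ p ^ e) • ((1 : K) ⊗ₜ[k] F m) := by
          rw [TensorProduct.smul_tmul', smul_eq_mul, mul_one]
        rw [this]
        exact Submodule.smul_mem _ _ (Submodule.subset_span ⟨F m, apply_mem_frobSpan hwN, rfl⟩)
    have hsmul : ∀ (c : K ⊗[k] R), ∀ x ∈ Submodule.span K ((fun v => (1 : K) ⊗ₜ[k] v) '' (P : Set M)),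
        c • x ∈ Submodule.span K ((fun v => (1 : K) ⊗ₜ[k] v) '' (P : Set M)) := by
      intro c x hx
      induction hx using Submodule.closure_induction with
      | zero => rw [smul_zero]; exact zero_mem _
      | add x y _ _ hx hy => rw [smul_add]; exact add_mem hx hy
      | smul_mem b w hw =>
        obtain ⟨m, hm, rfl⟩ := hw
        beta_reduce
        rw [TensorProduct.smul_tmul', smul_eq_mul, mul_one]
        induction c using TensorProduct.induction_on with
        | zero => rw [zero_smul]; exact zero_mem _
        | add c d hc hd => rw [add_smul]; exact add_mem hc hd
        | tmul a r =>
          rw [tmul_smul_tmul]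
          have : (a * b) ⊗ₜ[k] (r • m) = (a * b) • ((1 : K) ⊗ₜ[k] (r • m)) := by
            rw [TensorProduct.smul_tmul', smul_eq_mul, mul_one]
          rw [this]
          exact Submodule.smul_mem _ _ (Submodule.subset_span
            ⟨r • m, (frobSpan F (contraction N)).smul_mem r hm, rfl⟩)
    have hspan : ∀ y ∈ frobSpan (baseChange K F) N,
        y ∈ Submodule.span K ((fun v => (1 : K) ⊗ₜ[k] v) '' (P : Set M)) := by
      intro y hy
      induction hy using Submodule.span_induction with
      | mem y hy =>
        obtain ⟨x, hx, rfl⟩ := hy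
        exact hPK x hx
      | zero => exact zero_mem _
      | add x y _ _ hx hy => exact add_mem hx hy
      | smul c x _ hx => exact hsmul c x hx
    intro m hm
    exact mem_of_one_tmul_mem_span (hspan _ (hNe.ge (mem_contraction.1 hm)))

/-- A simple finitely generated unit module stays simple after extension of the algebraically
closed base field. -/
theorem isSimpleUnit_baseChange [IsAlgClosed k] [IsAlgClosed K] [Fact p.Prime] [CharP R p]
    [IsRegularRing R] [Algebra.EssFiniteType k R] (he : 0 < e) (hfg : IsFG F)
    (hF : IsSimpleUnit F) : IsSimpleUnit (baseChange (k := k) K F) := by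
  obtain ⟨hunit, hnt, hsimple⟩ := hF
  have hflat : Module.Flat R (FrobTwist R p e) := flat_frobTwist R p e
  have hflatK : Module.Flat (K ⊗[k] R) (FrobTwist (K ⊗[k] R) p e) :=
    flat_frobTwist_tensorProduct k K R p e
  have hnoeth : IsNoetherianRing (K ⊗[k] R) := Algebra.EssFiniteType.isNoetherianRing K _
  refine ⟨isUnitModule_baseChange hunit, ?_, fun N hN => ?_⟩
  · infer_instance
  · have hdesc := toSubspace_le_span_one_tmul he hunit hfg hN
    rcases hsimple _ (isUnitSubmodule_of_frobSpan_eq hunit (frobSpan_contraction_eq hN hdesc))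
      with h | h
    · left
      rw [eq_bot_iff]
      intro x hx
      have hx' := hdesc hx
      have hle : Submodule.span K {w | w ∈ toSubspace N ∧ ∃ m : M, (1 : K) ⊗ₜ[k] m = w} ≤ ⊥ := by
        rw [Submodule.span_le]
        rintro _ ⟨hw, m, rfl⟩
        have hm : m ∈ contraction N := hw
        rw [h, Submodule.mem_bot] at hm
        rw [hm, TensorProduct.tmul_zero]
        exact zero_mem _
      exact hle hx'
    · exact Or.inr (eq_top_of_contraction_eq_top h)

end UnitDescent

/-! ### Iterates of the Frobenius action. -/

section FrobPow

variable {R : Type*} [CommRing R] {p : ℕ} [ExpChar R p] {e : ℕ} {M : Type*} [AddCommGroup M]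
  [Module R M] {F : M →ₛₗ[iterateFrobenius R p e] M}

/-- The generators for `F^[r]` are the images of the old ones under `F^[i]` with `i < r`; steps of
length `r` reach all other exponents. -/
theorem isFG_frobPow (hF : IsFG F) {r : ℕ} (hr : 0 < r) : IsFG (frobPow F r) := by
  classical
  obtain ⟨S, hS⟩ := hF
  refine ⟨(Finset.range r).biUnion fun i => S.image F^[i], fun N hN hst => ?_⟩
  have hpow : ∀ i < r, ∀ s ∈ S, F^[i] s ∈ N := fun i hi s hs => hN (by
    simp only [Finset.coe_biUnion, Finset.coe_image, Set.mem_iUnion]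
    exact ⟨i, by simpa using hi, s, hs, rfl⟩)
  have hstep : ∀ n s, F^[n] s ∈ N → F^[r + n] s ∈ N := fun n s h => by
    rw [Function.iterate_add_apply]
    exact hst _ h
  have hall : ∀ s ∈ S, ∀ n, F^[n] s ∈ N := by
    intro s hs n
    induction n using Nat.strong_induction_on with
    | _ n ih =>
      rcases lt_or_ge n r with h | h
      · exact hpow n h s hs
      · obtain ⟨m, rfl⟩ := Nat.exists_eq_add_of_le h
        exact hstep m s (ih m (by omega))
  have htop := hS (Submodule.span R {x | ∃ s ∈ S, ∃ n, F^[n] s = x})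
    (fun s hs => Submodule.subset_span ⟨s, hs, 0, rfl⟩) (fun x hx => by
      induction hx using Submodule.span_induction with
      | mem x hx =>
        obtain ⟨s, hs, n, rfl⟩ := hx
        exact Submodule.subset_span ⟨s, hs, n + 1, Function.iterate_succ_apply' F n s⟩
      | zero => rw [map_zero]; exact zero_mem _
      | add x y _ _ hx hy => rw [map_add]; exact add_mem hx hy
      | smul a x _ hx => rw [LinearMap.map_smulₛₗ]; exact Submodule.smul_mem _ _ hx)
  rw [eq_top_iff, ← htop, Submodule.span_le]
  rintro _ ⟨s, hs, n, rfl⟩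
  exact hall s hs n

/-- The additive map `s ⊗ m ↦ r s ^ (p ^ e) ⊗ m`. -/
def pullbackComp (e e' : ℕ) (r : FrobTwist R p e) :
    Pullback R p e' M →+ Pullback R p (e + e') M :=
  TensorProduct.liftAddHom
    (AddMonoidHom.mk' (fun s => AddMonoidHom.mk'
      (fun m => (FrobTwist.toRing R p (e + e')).symm
        (FrobTwist.toRing R p e r * FrobTwist.toRing R p e' s ^ p ^ e) ⊗ₜ[R] m)
      (fun m n => TensorProduct.tmul_add _ _ _))
      (fun s t => by
        ext m
        change _ ⊗ₜ[R] _ = _ ⊗ₜ[R] _ + _ ⊗ₜ[R] _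
        rw [← TensorProduct.add_tmul, ← map_add, ← mul_add, ← add_pow_expChar_pow, map_add]))
    (fun a s m => by
      have h : (FrobTwist.toRing R p (e + e')).symm
          (FrobTwist.toRing R p e r * FrobTwist.toRing R p e' (a • s) ^ p ^ e) =
          a • (FrobTwist.toRing R p (e + e')).symm
            (FrobTwist.toRing R p e r * FrobTwist.toRing R p e' s ^ p ^ e) := by
        apply (FrobTwist.toRing R p (e + e')).injective
        rw [FrobTwist.toRing_smul, FrobTwist.toRing_smul, RingEquiv.apply_symm_apply,
          RingEquiv.apply_symm_apply, mul_pow, ← pow_mul, ← pow_add, add_comm e' e]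
        ring
      change (FrobTwist.toRing R p (e + e')).symm
        (FrobTwist.toRing R p e r * FrobTwist.toRing R p e' (a • s) ^ p ^ e) ⊗ₜ[R] m =
        _ ⊗ₜ[R] (a • m)
      rw [h, TensorProduct.smul_tmul])

theorem pullbackComp_tmul (e e' : ℕ) (r : FrobTwist R p e) (s : FrobTwist R p e') (m : M) :
    pullbackComp e e' r (s ⊗ₜ m) = (FrobTwist.toRing R p (e + e')).symm
        (FrobTwist.toRing R p e r * FrobTwist.toRing R p e' s ^ p ^ e) ⊗ₜ[R] m := rfl

theorem pullbackComp_add (e e' : ℕ) (r s : FrobTwist R p e) (t : Pullback R p e' M) :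
    pullbackComp e e' (r + s) t = pullbackComp e e' r t + pullbackComp e e' s t := by
  induction t using TensorProduct.induction_on with
  | zero => simp
  | add x y hx hy => rw [map_add, map_add, map_add, hx, hy]; abel
  | tmul a m =>
    rw [pullbackComp_tmul, pullbackComp_tmul, pullbackComp_tmul, ← TensorProduct.add_tmul,
      map_add, add_mul, map_add]

theorem pullbackComp_smul (e e' : ℕ) (a : R) (r : FrobTwist R p e) (t : Pullback R p e' M) :
    pullbackComp e e' (a • r) t =
      pullbackComp e e' r ((FrobTwist.toRing R p e').symm a • t) := by
  induction t using TensorProduct.induction_on with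
  | zero => simp
  | add x y hx hy => rw [map_add, smul_add, map_add, hx, hy]
  | tmul s m =>
    rw [TensorProduct.smul_tmul', pullbackComp_tmul, pullbackComp_tmul, smul_eq_mul,
      map_mul (FrobTwist.toRing R p e'), RingEquiv.apply_symm_apply, FrobTwist.toRing_smul, mul_pow]
    congr 2
    ring

/-- A composite of unit Frobenius structures is unit. -/
theorem IsUnitModule.comp {e' e'' : ℕ} {G : M →ₛₗ[iterateFrobenius R p e'] M}
    {H : M →ₛₗ[iterateFrobenius R p e''] M} (hF : IsUnitModule F) (hG : IsUnitModule G)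
    (he : e'' = e + e') (hH : ∀ x, H x = F (G x)) : IsUnitModule H := by
  subst he
  constructor
  · let θ := Equiv.ofBijective (theta F) hF
    let η := Equiv.ofBijective (theta G) hG
    have hθadd : ∀ x y, θ.symm (x + y) = θ.symm x + θ.symm y := fun x y => by
      apply θ.injective
      rw [Equiv.apply_symm_apply]
      change _ = theta F (_ + _)
      rw [map_add]
      exact congrArg₂ (· + ·) (θ.apply_symm_apply x).symm (θ.apply_symm_apply y).symm
    have hηadd : ∀ x y, η.symm (x + y) = η.symm x + η.symm y := fun x y => by
      apply η.injective
      rw [Equiv.apply_symm_apply]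
      change _ = theta G (_ + _)
      rw [map_add]
      exact congrArg₂ (· + ·) (η.apply_symm_apply x).symm (η.apply_symm_apply y).symm
    have hηsmul : ∀ (c : R) m, η.symm (c • m) = (FrobTwist.toRing R p e').symm c • η.symm m :=
      fun c m => by
        apply η.injective
        rw [Equiv.apply_symm_apply]
        change _ = theta G (_ • _)
        rw [LinearMap.map_smulₛₗ]
        change _ = c • η (η.symm m)
        rw [Equiv.apply_symm_apply]
    let Γ : Pullback R p e M →+ Pullback R p (e + e') M := TensorProduct.liftAddHom
      (AddMonoidHom.mk' (fun r => AddMonoidHom.mk' (fun m => pullbackComp e e' r (η.symm m))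
        (fun m n => by rw [hηadd, map_add]))
        (fun r s => by ext m; exact pullbackComp_add _ _ _ _ _))
      (fun c r m => by
        change pullbackComp e e' (c • r) (η.symm m) = pullbackComp e e' r (η.symm (c • m))
        rw [hηsmul, pullbackComp_smul])
    apply Function.LeftInverse.injective (g := fun m => Γ (θ.symm m))
    intro t
    beta_reduce
    induction t using TensorProduct.induction_on with
    | zero =>
      rw [map_zero]
      have : θ.symm 0 = 0 := by rw [Equiv.symm_apply_eq]; exact (map_zero (theta F)).symm
      rw [this, map_zero]
    | add x y hx hy => rw [map_add, hθadd, map_add, hx, hy]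
    | tmul r m =>
      have h1 : θ.symm (theta H (r ⊗ₜ m)) = (FrobTwist.toRing R p e).symm
          (FrobTwist.toRing R p (e + e') r) ⊗ₜ G m := by
        rw [Equiv.symm_apply_eq, theta_tmul, hH]
        rfl
      have h2 : η.symm (G m) = (1 : FrobTwist R p e') ⊗ₜ[R] m := by
        rw [Equiv.symm_apply_eq]
        change _ = theta G ((1 : FrobTwist R p e') ⊗ₜ[R] m)
        rw [theta_tmul, map_one, one_smul]
      rw [h1]
      change pullbackComp e e' _ (η.symm (G m)) = _
      rw [h2, pullbackComp_tmul, map_one, one_pow, mul_one, RingEquiv.apply_symm_apply,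
        RingEquiv.symm_apply_apply]
  · have h : ∀ y ∈ frobSpan F (frobSpan G ⊤), y ∈ frobSpan H ⊤ := by
      rw [frobSpan_top hG]
      change frobSpan F ⊤ ≤ frobSpan H ⊤
      rw [frobSpan_le_iff]
      intro x _
      obtain ⟨z, rfl⟩ := hG.2 x
      induction z using TensorProduct.induction_on with
      | zero => rw [map_zero, map_zero]; exact zero_mem _
      | add x y hx hy => rw [map_add, map_add]; exact add_mem (hx trivial) (hy trivial)
      | tmul r m =>
        rw [theta_tmul, LinearMap.map_smulₛₗ, ← hH]
        exact Submodule.smul_mem _ _ (apply_mem_frobSpan trivial)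
    rw [frobSpan_top hG, frobSpan_top hF] at h
    intro y
    obtain ⟨z, hz⟩ := mem_frobSpan_iff.1 (h y trivial)
    exact ⟨_, hz⟩

theorem IsUnitModule.congr {e' : ℕ} {H : M →ₛₗ[iterateFrobenius R p e'] M} (hF : IsUnitModule F)
    (he : e' = e) (hH : ∀ x, H x = F x) : IsUnitModule H := by
  subst he
  rwa [show H = F from LinearMap.ext hH]

theorem isUnitModule_frobPow (hF : IsUnitModule F) {r : ℕ} (hr : 0 < r) :
    IsUnitModule (frobPow F r) := by
  induction r, hr using Nat.le_induction with
  | base => exact hF.congr (mul_one e) fun _ => rfl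
  | succ r _ ih => exact ih.comp hF (Nat.mul_succ e r) fun _ => rfl

theorem frobPow_baseChange {k K : Type*} [Field k] [Field K] [Algebra k K] [Algebra k R]
    [Module k M] [IsScalarTower k R M] (r : ℕ) :
    frobPow (baseChange (k := k) K F) r = baseChange K (frobPow F r) := by
  ext x
  change (baseChange K F)^[r] x = _
  induction x using TensorProduct.induction_on with
  | zero => rw [map_zero, iterate_map_zero]
  | add x y hx hy => rw [map_add, iterate_map_add, hx, hy]
  | tmul a m =>
    rw [baseChange_tmul]
    change _ = _ ⊗ₜ[k] (F^[r] m)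
    induction r with
    | zero => simp
    | succ r ih =>
      rw [Function.iterate_succ_apply', ih, baseChange_tmul, ← pow_mul, ← pow_add,
        Function.iterate_succ_apply', Nat.mul_succ]

end FrobPow

end FrobMod

theorem proposition4
    {k K R M : Type*} [Field k] [IsAlgClosed k] [Field K] [IsAlgClosed K] [Algebra k K]
    [CommRing R] [Algebra k R] [IsRegularRing R] [Algebra.EssFiniteType k R]
    (p : ℕ) [Fact p.Prime] [CharP R p]
    [AddCommGroup M] [Module k M] [Module R M] [IsScalarTower k R M]
    (e : ℕ) (he : 0 < e) (F : M →ₛₗ[iterateFrobenius R p e] M) (hfg : FrobMod.IsFG F) :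
    (FrobMod.IsSimpleUnit F → FrobMod.IsSimpleUnit (FrobMod.baseChange (k := k) K F)) ∧
    (FrobMod.IsSimpleUnitLim F →
      FrobMod.IsSimpleUnitLim (FrobMod.baseChange (k := k) K F)) := by
  refine ⟨FrobMod.isSimpleUnit_baseChange he hfg, fun ⟨hunit, hnt, hsimple⟩ => ?_⟩
  -- Simplicity in the limit is simplicity for each iterate, to which the first assertion applies
  -- with `e * r` in place of `e`.
  have hpow : ∀ r, 0 < r →
      FrobMod.IsSimpleUnit (FrobMod.baseChange (k := k) K (FrobMod.frobPow F r)) := fun r hr =>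
    FrobMod.isSimpleUnit_baseChange (Nat.mul_pos he hr) (FrobMod.isFG_frobPow hfg hr)
      ⟨FrobMod.isUnitModule_frobPow hunit hr, hnt, fun N hN => hsimple N ⟨r, hr, hN⟩⟩
  refine ⟨FrobMod.isUnitModule_baseChange hunit, (hpow 1 one_pos).2.1, ?_⟩
  rintro N ⟨r, hr, hN⟩
  rw [FrobMod.frobPow_baseChange] at hN
  exact (hpow r hr).2.2 N hN
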